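/- Let $q$ be a complex number with $0<|q|<1$. Write $(a;q)_\infty=\prod_{j\ge 0}(1-aq^j)$, $(a;q)_k=(a;q)_\infty/(aq^k;q)_\infty$ for $k\in\mathbb Z$, $(a)_k=(a;q)_k$ for $k\in\mathbb{Z}\cup\{\infty\}$, and $(x,y,z;q)_\infty=(x;q)_\infty(y;q)_\infty(z;q)_\infty$. For integers $N\ge 0$ and $j$ let $\left[{N\atop j}\right]_{q}=\frac{(q;q)_N}{(q;q)_j(q;q)_{N-j}}$ if $0\le j\le N$, and $\left[{N\atop j}\right]_q=0$ otherwise. **Theorem 2.5** ($m$-version of the Bressoud identities). Let $m\ge 0$, $r\ge 2$ and $0\le i\le r-1$ be integers. Then $$\sum_{s_1\ge\dots\ge s_r\ge-\lfloor m/2\rfloor}\frac{q^{s_1^2+\dots+s_r^2+m(s_1+\dots+s_{r-1})-s_1-\dots-s_i}\,(-q)_{m+2s_r-1}}{(q)_{s_1-s_2}\cdots(q)_{s_{r-2}-s_{r-1}}\,(q^2;q^2)_{s_{r-1}-s_r}}(-1)^{s_r}\left[{m+s_r\atop m+2s_r}\right]_{q^2}=a_m,$$ where the sum runs over all such $(s_1,\dots,s_r)\in\mathbb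 Z^r$ and converges absolutely, and where, for every integer $m\ge 0$, $$a_{2m}=\sum_{k=0}^{i}\sum_{\ell=0}^{2m}(-1)^\ell q^{2mk+2m\ell}\,\frac{\bigl(q^{2r},\,q^{2m(r-1)+r-i+2k+2\ell},\,q^{r+i-2m(r-1)-2k-2\ell};\,q^{2r}\bigr)_\infty}{2(q)_\infty}$$ and $$a_{2m+1}=(-1)^m q^{(2-r)m^2+(1+i-r)m}\sum_{\ell=0}^{m}q^{2\ell}\,\frac{\bigl(q^{2r},\,q^{2r-2m-1-i+4\ell},\,q^{i+2m+1-4\ell};\,q^{2r}\bigr)_\infty}{(q)_\infty}.$$ -/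

import Mathlib

noncomputable section

/-- The infinite `q`-shifted factorial `(a; q)_∞ = ∏_{j ≥ 0} (1 - a q^j)`
(used for `‖q‖ < 1`, where the product converges). -/
def qPochInf (a q : ℂ) : ℂ := ∏' j : ℕ, (1 - a * q ^ j)

/-- The `q`-shifted factorial `(a; q)_k = (a; q)_∞ / (a q^k; q)_∞`, for every integer `k`. -/
def qPoch (a q : ℂ) (k : ℤ) : ℂ := qPochInf a q / qPochInf (a * q ^ k) q

/-- The triple product `(x, y, z; q)_∞ = (x; q)_∞ (y; q)_∞ (z; q)_∞`. -/
def qPochInf₃ (x y z q : ℂ) : ℂ := qPochInf x q * qPochInf y q * qPochInf z q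

/-- The `q`-binomial coefficient `[N, j]_q = (q; q)_N / ((q; q)_j (q; q)_{N - j})` for
`0 ≤ j ≤ N`, and `0` for `j < 0` or `j > N`. -/
def qBinom (q : ℂ) (N j : ℤ) : ℂ :=
  if 0 ≤ j ∧ j ≤ N then qPoch q q N / (qPoch q q j * qPoch q q (N - j)) else 0

/-- The index set of the multisum: integer sequences `s_1 ≥ s_2 ≥ ⋯ ≥ s_r ≥ -⌊m/2⌋`.
Here and below `s_j` is the value of `s : Fin r → ℤ` at the element `j - 1` of `Fin r`. -/
def multisumIndex (m r : ℕ) : Set (Fin r → ℤ) :=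
  {s | Antitone s ∧ ∀ j, -((m / 2 : ℕ) : ℤ) ≤ s j}

/-- The exponent `s_1² + ⋯ + s_r² + m (s_1 + ⋯ + s_{r-1}) - s_1 - ⋯ - s_i`. -/
def multisumExponent (m r i : ℕ) (s : Fin r → ℤ) : ℤ :=
  ∑ j : Fin r, s j ^ 2 + (m : ℤ) * ∑ j : Fin r with j.val + 1 < r, s j
    - ∑ j : Fin r with j.val < i, s j

/-- The summand of the multisum, namely
`q^(s_1² + ⋯ + s_r² + m (s_1 + ⋯ + s_{r-1}) - s_1 - ⋯ - s_i) (-q; q)_{m + 2 s_r - 1}`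
divided by `(q; q)_{s_1 - s_2} ⋯ (q; q)_{s_{r-2} - s_{r-1}} (q²; q²)_{s_{r-1} - s_r}`,
times `(-1)^{s_r} [m + s_r, m + 2 s_r]_{q²}`. -/
def multisumTerm (q : ℂ) (m r i : ℕ) (hr : 2 ≤ r) (s : Fin r → ℤ) : ℂ :=
  let last : ℤ := s ⟨r - 1, by omega⟩
  let prev : ℤ := s ⟨r - 2, by omega⟩
  q ^ multisumExponent m r i s * qPoch (-q) q (m + 2 * last - 1)
    / ((∏ j : Fin (r - 2), qPoch q q (s ⟨j, by omega⟩ - s ⟨j + 1, by omega⟩))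
        * qPoch (q ^ 2) (q ^ 2) (prev - last))
    * (-1) ^ last * qBinom (q ^ 2) (m + last) (m + 2 * last)

/-- The value `a_{2m}`. -/
def bressoudEven (q : ℂ) (m r i : ℕ) : ℂ :=
  ∑ k ∈ Finset.range (i + 1), ∑ l ∈ Finset.range (2 * m + 1),
    (-1) ^ l * q ^ (2 * m * k + 2 * m * l) *
      (qPochInf₃ (q ^ (2 * r))
          (q ^ (2 * m * (r - 1) + r - i + 2 * k + 2 * l : ℤ))
          (q ^ (r + i - 2 * m * (r - 1) - 2 * k - 2 * l : ℤ))
          (q ^ (2 * r))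
        / (2 * qPochInf q q))

/-- The value `a_{2m+1}`. -/
def bressoudOdd (q : ℂ) (m r i : ℕ) : ℂ :=
  (-1) ^ m * q ^ ((2 - r) * m ^ 2 + (1 + i - r) * m : ℤ) *
    ∑ l ∈ Finset.range (m + 1),
      q ^ (2 * l) *
        (qPochInf₃ (q ^ (2 * r))
            (q ^ (2 * r - 2 * m - 1 - i + 4 * l : ℤ))
            (q ^ (i + 2 * m + 1 - 4 * l : ℤ))
            (q ^ (2 * r))
          / qPochInf q q)

/-- The sequence `a_0, a_1, a_2, …`, given separately for even and for odd indices. -/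
def bressoudA (q : ℂ) (m r i : ℕ) : ℂ :=
  if Even m then bressoudEven q (m / 2) r i else bressoudOdd q (m / 2) r i

end

/-! The multisum is an iterated Bailey chain. `hasSum_unit_bailey` expands the signed q-binomial
coefficient in s_r over an index j ∈ ℤ, with the kernel 1/((q)_{n-j} (q)_{m+n+j}) taken in base q².
Summing over s_r turns this into the kernel in base q and creates the denominator 1 + x, where x =
q^(m+2j) (`hasSum_bailey_changeOfBase`). Each sum over s_{r-1}, ..., s_1 then reproduces the kernel
up to explicit factors: by `hasSum_bailey` for a variable without the extra linear exponent, by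
`hasSum_bailey_lattice` for the i largest ones, which build up the sum 1 + x + ... + x^i. An
auxiliary bound n ≥ s_1 keeps the range of j finite (`hasSum_chainTerm`); letting n → ∞ by dominated
convergence identifies (q)_∞ times the multisum with the bilateral series of `thetaTerm`
(`hasSum_multisumTerm`).

The denominator is removed by the symmetry j ↦ -m-j, under which x ↦ 1/x (`thetaTerm_reflect`).
Adding a term to its mirror image multiplies it by 1 + (-1)^m x^(m+1), which is divisible by 1 + x.
For even m the quotient is an alternating geometric sum and a factor 1/2 remains. For odd m it is 1
- x times a geometric sum in x²; the factor 1 - x collapses 1 + ... + x^i to 1 - x^(i+1), which is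
again a sum of two mirror images, so the factor 1/2 disappears. The surviving series are evaluated
by `hasSum_tripleProduct`. -/

open Filter Topology

/-! ### Infinite products and reciprocal q-factorials -/

section Basic

variable {a q : ℂ}

lemma summable_norm_mul_pow (a : ℂ) (hq₁ : ‖q‖ < 1) : Summable fun j : ℕ => ‖-(a * q ^ j)‖ := by
  simp only [norm_neg, norm_mul, norm_pow]
  exact (summable_geometric_of_lt_one (norm_nonneg _) hq₁).mul_left _

lemma multipliable_qPochInf (a : ℂ) (hq₁ : ‖q‖ < 1) :
    Multipliable fun j : ℕ => (1 - a * q ^ j) := by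
  simpa only [sub_eq_add_neg] using
    multipliable_one_add_of_summable (summable_norm_mul_pow a hq₁)

lemma tendsto_prod_qPochInf (a : ℂ) (hq₁ : ‖q‖ < 1) :
    Tendsto (fun n => ∏ j ∈ Finset.range n, (1 - a * q ^ j)) atTop (𝓝 (qPochInf a q)) :=
  (multipliable_qPochInf a hq₁).hasProd.tendsto_prod_nat

lemma qPochInf_ne_zero (hq₁ : ‖q‖ < 1) (h : ∀ j : ℕ, a * q ^ j ≠ 1) : qPochInf a q ≠ 0 := by
  have := tprod_one_add_ne_zero_of_summable (f := fun j : ℕ => -(a * q ^ j))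
    (fun j => by rw [← sub_eq_add_neg]; exact sub_ne_zero.2 (h j).symm)
    (summable_norm_mul_pow a hq₁)
  simpa only [qPochInf, sub_eq_add_neg] using this

lemma qPochInf_eq_mul (a : ℂ) (hq₁ : ‖q‖ < 1) :
    qPochInf a q = (1 - a) * qPochInf (a * q) q := by
  have h : Multipliable fun j : ℕ => (1 - a * q ^ (j + 1)) := by
    simpa only [pow_succ', mul_assoc] using multipliable_qPochInf (a * q) hq₁
  have h' := tprod_eq_zero_mul' (f := fun j : ℕ => (1 - a * q ^ j)) h
  simpa only [qPochInf, pow_succ', mul_assoc, pow_zero, mul_one] using h'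

lemma zpow_ne_one_of_norm_lt_one (hq₀ : q ≠ 0) (hq₁ : ‖q‖ < 1) {k : ℤ} (hk : k ≠ 0) :
    ‖q ^ k‖ ≠ 1 := by
  rw [norm_zpow]
  intro h
  have h0 : 0 < ‖q‖ := norm_pos_iff.2 hq₀
  rcases lt_or_gt_of_ne hk with hk | hk
  · exact (one_lt_zpow_of_neg₀ h0 hq₁ hk).ne' h
  · exact (zpow_lt_one₀ h0 hq₁ hk).ne h

lemma one_add_zpow_ne_zero (hq₀ : q ≠ 0) (hq₁ : ‖q‖ < 1) (k : ℤ) : 1 + q ^ k ≠ 0 := by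
  rcases eq_or_ne k 0 with rfl | hk
  · norm_num
  · intro h
    apply zpow_ne_one_of_norm_lt_one hq₀ hq₁ hk
    rw [eq_neg_of_add_eq_zero_right h, norm_neg, norm_one]

lemma one_sub_zpow_ne_zero (hq₀ : q ≠ 0) (hq₁ : ‖q‖ < 1) {k : ℤ} (hk : k ≠ 0) :
    1 - q ^ k ≠ 0 := by
  intro h
  apply zpow_ne_one_of_norm_lt_one hq₀ hq₁ hk
  rw [← sub_eq_zero.1 h, norm_one]

lemma qPochInf_self_ne_zero (hq₀ : q ≠ 0) (hq₁ : ‖q‖ < 1) : qPochInf q q ≠ 0 := by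
  refine qPochInf_ne_zero hq₁ fun j h => ?_
  have := one_sub_zpow_ne_zero hq₀ hq₁ (k := (j : ℤ) + 1) (by omega)
  rw [zpow_add_one₀ hq₀, zpow_natCast, mul_comm, h] at this
  simp at this

/-- The reciprocal `1 / (q; q)_k` of the `q`-factorial; it vanishes for `k < 0`. -/
noncomputable def qFacInv (q : ℂ) (k : ℤ) : ℂ := (qPoch q q k)⁻¹

lemma qFacInv_eq (q : ℂ) (k : ℤ) : qFacInv q k = qPochInf (q * q ^ k) q / qPochInf q q := by
  rw [qFacInv, qPoch, inv_div]

lemma qFacInv_zero (hq₀ : q ≠ 0) (hq₁ : ‖q‖ < 1) : qFacInv q 0 = 1 := by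
  rw [qFacInv_eq, zpow_zero, mul_one, div_self (qPochInf_self_ne_zero hq₀ hq₁)]

/-- Peeling one factor off the infinite product works for every integer k, negative ones included.
The inductions below therefore need no boundary cases. -/
lemma qFacInv_rec (hq₀ : q ≠ 0) (hq₁ : ‖q‖ < 1) {k l : ℤ} (h : k + 1 = l) :
    qFacInv q k = (1 - q ^ l) * qFacInv q l := by
  subst h
  rw [qFacInv_eq, qFacInv_eq, qPochInf_eq_mul _ hq₁, zpow_add_one₀ hq₀]
  ring_nf

/-- The product (q^(k+1); q)_∞ contains the factor 1 - q^0. This vanishing truncates every sum over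
ℤ below to its natural range. -/
lemma qFacInv_of_neg (hq₀ : q ≠ 0) {k : ℤ} (hk : k < 0) : qFacInv q k = 0 := by
  rw [qFacInv_eq, qPochInf, tprod_of_exists_eq_zero, zero_div]
  refine ⟨(-k - 1).toNat, ?_⟩
  rw [← zpow_natCast, Int.toNat_of_nonneg (by omega), mul_assoc, ← zpow_add₀ hq₀,
    ← zpow_one_add₀ hq₀]
  ring_nf
  simp

lemma qFacInv_natCast (hq₀ : q ≠ 0) (hq₁ : ‖q‖ < 1) (k : ℕ) :
    qFacInv q k = (∏ j ∈ Finset.range k, (1 - q * q ^ j))⁻¹ := by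
  induction k with
  | zero => simpa using qFacInv_zero hq₀ hq₁
  | succ k ih =>
    have h := qFacInv_rec hq₀ hq₁ (k := k) (l := (k + 1 : ℕ)) (by push_cast; ring)
    have h' := one_sub_zpow_ne_zero hq₀ hq₁ (k := (k + 1 : ℕ)) (by positivity)
    rw [Finset.prod_range_succ, mul_inv, ← ih, h, ← pow_succ', ← zpow_natCast]
    field_simp

lemma qFacInv_ne_zero (hq₀ : q ≠ 0) (hq₁ : ‖q‖ < 1) {k : ℤ} (hk : 0 ≤ k) :
    qFacInv q k ≠ 0 := by
  lift k to ℕ using hk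
  rw [qFacInv_natCast hq₀ hq₁]
  refine inv_ne_zero (Finset.prod_ne_zero_iff.2 fun j _ => ?_)
  rw [← pow_succ', ← zpow_natCast]
  exact one_sub_zpow_ne_zero hq₀ hq₁ (by positivity)

lemma tendsto_qFacInv_natCast (hq₀ : q ≠ 0) (hq₁ : ‖q‖ < 1) :
    Tendsto (fun n : ℕ => qFacInv q n) atTop (𝓝 (qPochInf q q)⁻¹) := by
  simp only [qFacInv_natCast hq₀ hq₁]
  exact (tendsto_prod_qPochInf q hq₁).inv₀ (qPochInf_self_ne_zero hq₀ hq₁)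

lemma tendsto_qFacInv (hq₀ : q ≠ 0) (hq₁ : ‖q‖ < 1) :
    Tendsto (qFacInv q) atTop (𝓝 (qPochInf q q)⁻¹) := by
  have h' : Tendsto Int.toNat atTop atTop := tendsto_atTop.2 fun b => by
    filter_upwards [eventually_ge_atTop (b : ℤ)] with k hk
    omega
  have h := (tendsto_qFacInv_natCast hq₀ hq₁).comp h'
  refine h.congr' ?_
  filter_upwards [eventually_ge_atTop 0] with k hk
  simp [Int.toNat_of_nonneg hk]

lemma exists_norm_qFacInv_le (hq₀ : q ≠ 0) (hq₁ : ‖q‖ < 1) :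
    ∃ C : ℝ, 0 < C ∧ ∀ k, ‖qFacInv q k‖ ≤ C := by
  obtain ⟨C, hC⟩ := (tendsto_qFacInv_natCast hq₀ hq₁).norm.bddAbove_range
  refine ⟨max C 1, by positivity, fun k => ?_⟩
  rcases lt_or_ge k 0 with hk | hk
  · rw [qFacInv_of_neg hq₀ hk, norm_zero]
    positivity
  · lift k to ℕ using hk
    exact (hC ⟨k, rfl⟩).trans (le_max_left _ _)

lemma qPoch_neg_self_rec (hq₀ : q ≠ 0) (hq₁ : ‖q‖ < 1) {k l : ℤ} (h : k + 1 = l) :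
    qPoch (-q) q l = qPoch (-q) q k * (1 + q ^ l) := by
  subst h
  have h0 : ∀ k : ℤ, qPochInf (-q * q ^ k) q ≠ 0 := fun k => by
    refine qPochInf_ne_zero hq₁ fun j h => one_add_zpow_ne_zero hq₀ hq₁ (k + j + 1) ?_
    rw [zpow_add_one₀ hq₀, zpow_add₀ hq₀, zpow_natCast]
    linear_combination -h
  have h1 := qPochInf_eq_mul (-q * q ^ k) hq₁
  have h2 := h0 (k + 1)
  have h3 := h0 k
  have h4 : -q * q ^ (k + 1) = -q * q ^ k * q := by rw [zpow_add_one₀ hq₀]; ring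
  rw [h4] at h2
  rw [qPoch, qPoch, h4, div_mul_eq_mul_div, div_eq_div_iff h2 h3, h1, zpow_add_one₀ hq₀]
  ring

lemma qPoch_neg_self_zero (hq₀ : q ≠ 0) (hq₁ : ‖q‖ < 1) : qPoch (-q) q 0 = 1 := by
  rw [qPoch, zpow_zero, mul_one, div_self]
  refine qPochInf_ne_zero hq₁ fun j h => one_add_zpow_ne_zero hq₀ hq₁ (j + 1) ?_
  rw [zpow_add_one₀ hq₀, zpow_natCast]
  linear_combination -h

lemma sq_ne_zero_and_norm_sq_lt_one (hq₀ : q ≠ 0) (hq₁ : ‖q‖ < 1) :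
    q ^ 2 ≠ 0 ∧ ‖q ^ 2‖ < 1 :=
  ⟨pow_ne_zero 2 hq₀, by rw [norm_pow]; exact pow_lt_one₀ (norm_nonneg _) hq₁ two_ne_zero⟩

/-- This is (q²; q²)_k = (q; q)_k (-q; q)_k, with both sides zero for negative k. -/
lemma qPoch_neg_self_mul_qFacInv (hq₀ : q ≠ 0) (hq₁ : ‖q‖ < 1) (k : ℤ) :
    qPoch (-q) q k * qFacInv (q ^ 2) k = qFacInv q k := by
  obtain ⟨hp₀, hp₁⟩ := sq_ne_zero_and_norm_sq_lt_one hq₀ hq₁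
  rcases lt_or_ge k 0 with hk | hk
  · rw [qFacInv_of_neg hp₀ hk, qFacInv_of_neg hq₀ hk, mul_zero]
  · lift k to ℕ using hk
    induction k with
    | zero => simp [qPoch_neg_self_zero hq₀ hq₁, qFacInv_zero hq₀ hq₁, qFacInv_zero hp₀ hp₁]
    | succ k ih =>
      have e : (k : ℤ) + 1 = (k + 1 : ℕ) := by push_cast; ring
      have h' := one_sub_zpow_ne_zero hq₀ hq₁ (k := (k + 1 : ℕ)) (by positivity)
      rw [qFacInv_rec hq₀ hq₁ e, qFacInv_rec hp₀ hp₁ e] at ih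
      rw [qPoch_neg_self_rec hq₀ hq₁ e]
      apply mul_left_cancel₀ h'
      rw [← ih, ← zpow_natCast q 2, ← zpow_mul, mul_comm, zpow_mul]
      norm_cast
      ring

lemma qPoch_neg_self_pred_mul_qFacInv (hq₀ : q ≠ 0) (hq₁ : ‖q‖ < 1) (k : ℤ) :
    qPoch (-q) q (k - 1) * qFacInv (q ^ 2) k = qFacInv q k / (1 + q ^ k) := by
  rw [eq_div_iff (one_add_zpow_ne_zero hq₀ hq₁ k), ← qPoch_neg_self_mul_qFacInv hq₀ hq₁,
    qPoch_neg_self_rec hq₀ hq₁ (sub_add_cancel k 1)]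
  ring

end Basic

/-! ### Terminating summation formulas -/

section FiniteSums

variable {q : ℂ}

lemma summable_of_eq_zero_outside {f : ℤ → ℂ} (a b : ℤ) (ha : ∀ t < a, f t = 0)
    (hb : ∀ t, b < t → f t = 0) : Summable f := by
  refine summable_of_ne_finset_zero (s := Finset.Icc a b) fun t ht => ?_
  rw [Finset.mem_Icc, not_and_or, not_le, not_le] at ht
  exact ht.elim (ha t) (hb t)

lemma hasSum_sub_one_iff {f : ℤ → ℂ} {a : ℂ} : HasSum (fun t => f (t - 1)) a ↔ HasSum f a :=
  (Equiv.subRight (1 : ℤ)).hasSum_iff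

lemma hasSum_telescope {u : ℤ → ℂ} (hu : Summable u) : HasSum (fun t => u (t - 1) - u t) 0 := by
  simpa using (hasSum_sub_one_iff.2 hu.hasSum).sub hu.hasSum

lemma hasSum_of_eq_zero_of_ne_zero {f : ℤ → ℂ} {a : ℂ} (h0 : f 0 = a)
    (h : ∀ t, t ≠ 0 → f t = 0) : HasSum f a :=
  h0 ▸ hasSum_single 0 h

lemma zpow_of_eq_add (hq₀ : q ≠ 0) {a b c : ℤ} (h : c = a + b) : q ^ c = q ^ a * q ^ b := by
  rw [h, zpow_add₀ hq₀]

lemma qFacInv_neg_mul_self (hq₀ : q ≠ 0) {t : ℤ} (ht : t ≠ 0) :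
    qFacInv q (-t) * qFacInv q t = 0 := by
  rcases lt_or_gt_of_ne ht with h | h
  · rw [qFacInv_of_neg hq₀ h, mul_zero]
  · rw [qFacInv_of_neg hq₀ (neg_lt_zero.2 h), zero_mul]

/-- The `q`-Chu–Vandermonde summation behind the Bailey lemma. -/
lemma hasSum_qVandermonde (hq₀ : q ≠ 0) (hq₁ : ‖q‖ < 1) (N : ℕ) (M : ℤ) :
    HasSum (fun t : ℤ =>
        q ^ (t ^ 2 + M * t) * (qFacInv q (N - t) * qFacInv q t * qFacInv q (M + t)))
      (qFacInv q N * qFacInv q (M + N)) := by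
  induction N generalizing M with
  | zero =>
    refine hasSum_of_eq_zero_of_ne_zero ?_ ?_
    · simp [qFacInv_zero hq₀ hq₁]
    · intro t ht
      simp [qFacInv_neg_mul_self hq₀ ht]
  | succ N ih =>
    -- A telescoping certificate: (1 - q^(N+1)) times the summand for (N+1, M) is the summand for
    -- (N, M+1) plus u(t-1) - u(t).
    set u : ℤ → ℂ := fun t => q ^ (M + 1 + (t ^ 2 + (M + 2) * t)) *
      (qFacInv q (N - t) * qFacInv q t * qFacInv q (M + 1 + t)) with hu
    have hus : Summable u := summable_of_eq_zero_outside 0 N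
      (fun t ht => by simp [hu, qFacInv_of_neg hq₀ ht])
      (fun t ht => by simp [hu, qFacInv_of_neg hq₀ (sub_neg.2 ht)])
    have hb := one_sub_zpow_ne_zero hq₀ hq₁ (k := (N + 1 : ℕ)) (by positivity)
    have key := ((ih (M + 1)).add (hasSum_telescope hus)).mul_left (1 - q ^ ((N + 1 : ℕ) : ℤ))⁻¹
    convert! key using 1
    · funext t
      rw [eq_inv_mul_iff_mul_eq₀ hb]
      simp only [hu]
      rw [qFacInv_rec hq₀ hq₁ (k := (N : ℤ) - t) (l := (N + 1 : ℕ) - t) (by push_cast; ring),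
        qFacInv_rec hq₀ hq₁ (k := t - 1) (l := t) (by ring),
        qFacInv_rec hq₀ hq₁ (k := M + t) (l := M + 1 + t) (by ring),
        show (N : ℤ) - (t - 1) = (N + 1 : ℕ) - t by push_cast; ring,
        show M + 1 + (t - 1) = M + t by ring,
        qFacInv_rec hq₀ hq₁ (k := M + t) (l := M + 1 + t) (by ring),
        show M + 1 + ((t - 1) ^ 2 + (M + 2) * (t - 1)) = t ^ 2 + M * t by ring,
        zpow_of_eq_add hq₀ (show t ^ 2 + (M + 1) * t = t ^ 2 + M * t + t by ring),
        zpow_of_eq_add hq₀ (show M + 1 + (t ^ 2 + (M + 2) * t) =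
          t ^ 2 + M * t + t + (M + 1 + t) by ring),
        zpow_of_eq_add hq₀ (show t ^ 2 + M * t + t = t ^ 2 + M * t + t by ring),
        zpow_of_eq_add hq₀ (show ((N + 1 : ℕ) : ℤ) = ((N + 1 : ℕ) - t) + t by ring)]
      ring
    · rw [eq_inv_mul_iff_mul_eq₀ hb, add_zero, qFacInv_rec hq₀ hq₁ (k := N) (l := (N + 1 : ℕ))
        (by push_cast; ring)]
      push_cast
      ring_nf

/-- The summation formulas behind the change of base from `q ^ 2` to `q` in the Bailey lemma. -/
lemma hasSum_changeOfBase (hq₀ : q ≠ 0) (hq₁ : ‖q‖ < 1) (N : ℕ) (M : ℤ) :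
    HasSum (fun t : ℤ => qPoch (-q) q (M + 2 * t - 1) * q ^ t * (qFacInv (q ^ 2) (N - t) *
        qFacInv (q ^ 2) t * qFacInv (q ^ 2) (M + t)))
      (qFacInv q N * qFacInv q (M + N) / (1 + q ^ M)) ∧
    HasSum (fun t : ℤ => qPoch (-q) q (M + 2 * t) * q ^ (-t) * (qFacInv (q ^ 2) (N - t) *
        qFacInv (q ^ 2) t * qFacInv (q ^ 2) (M + t)))
      (q ^ (-N : ℤ) * (qFacInv q N * qFacInv q (M + N))) := by
  obtain ⟨hp₀, hp₁⟩ := sq_ne_zero_and_norm_sq_lt_one hq₀ hq₁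
  have hsq : ∀ k : ℤ, (q ^ 2) ^ k = q ^ k * q ^ k := fun k => by
    rw [pow_two, mul_zpow]
  -- The two formulas are proved together because each inductive step uses both of them, with M
  -- raised to M + 1.
  induction N generalizing M with
  | zero =>
    constructor
    · refine hasSum_of_eq_zero_of_ne_zero ?_ ?_
      · simp [qFacInv_zero hq₀ hq₁, qFacInv_zero hp₀ hp₁,
          qPoch_neg_self_pred_mul_qFacInv hq₀ hq₁]
      · intro t ht
        simp [qFacInv_neg_mul_self hp₀ ht]
    · refine hasSum_of_eq_zero_of_ne_zero ?_ ?_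
      · simp [qFacInv_zero hq₀ hq₁, qFacInv_zero hp₀ hp₁, qPoch_neg_self_mul_qFacInv hq₀ hq₁]
      · intro t ht
        simp [qFacInv_neg_mul_self hp₀ ht]
  | succ N ih =>
    have hb := one_sub_zpow_ne_zero hp₀ hp₁ (k := (N + 1 : ℕ)) (by positivity)
    have hM := one_add_zpow_ne_zero hq₀ hq₁ M
    have hM' := one_add_zpow_ne_zero hq₀ hq₁ (M + 1)
    have eN : ((N : ℤ) + 1) = ((N + 1 : ℕ) : ℤ) := by push_cast; ring
    constructor
    -- The split is 1 - p^(N+1) = (1 - p^(N+1-t)) + p^(N+1-t) (1 - p^t) with p = q²: the first part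
    -- lowers N - t, the second lowers t and so calls for a shift of the index.
    · have key := ((ih M).1.add ((hasSum_sub_one_iff.2 (ih (M + 1)).2).mul_left
        (q ^ (2 * N + 1 : ℤ)))).mul_left (1 - (q ^ 2) ^ ((N + 1 : ℕ) : ℤ))⁻¹
      convert! key using 1
      · funext t
        rw [eq_inv_mul_iff_mul_eq₀ hb,
          qFacInv_rec hp₀ hp₁ (k := (N : ℤ) - t) (l := (N + 1 : ℕ) - t) (by push_cast; ring),
          qFacInv_rec hp₀ hp₁ (k := t - 1) (l := t) (by ring),
          show (N : ℤ) - (t - 1) = (N + 1 : ℕ) - t by push_cast; ring,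
          show M + 1 + (t - 1) = M + t by ring,
          show M + 1 + 2 * (t - 1) = M + 2 * t - 1 by ring,
          zpow_of_eq_add (c := ((N + 1 : ℕ) : ℤ)) hp₀
            (show ((N + 1 : ℕ) : ℤ) = ((N + 1 : ℕ) - t) + t by ring)]
        have e1 : q ^ (2 * N + 1 : ℤ) * q ^ (-(t - 1)) = (q ^ 2) ^ (((N + 1 : ℕ) : ℤ) - t) * q ^ t := by
          rw [hsq, ← zpow_add₀ hq₀, ← zpow_add₀ hq₀, ← zpow_add₀ hq₀]
          congr 1
          push_cast
          ring
        linear_combination (-(qPoch (-q) q (M + 2 * t - 1) * (qFacInv (q ^ 2) ((N + 1 : ℕ) - t) *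
          ((1 - (q ^ 2) ^ t) * qFacInv (q ^ 2) t) * qFacInv (q ^ 2) (M + t)))) * e1
      · have e1 : q ^ (2 * N + 1 : ℤ) * q ^ (-N : ℤ) = q ^ ((N + 1 : ℕ) : ℤ) := by
          rw [← zpow_add₀ hq₀]
          congr 1
          push_cast
          ring
        rw [eq_inv_mul_iff_mul_eq₀ hb,
          qFacInv_rec hq₀ hq₁ (k := N) (l := (N + 1 : ℕ)) (by push_cast; ring),
          qFacInv_rec hq₀ hq₁ (k := M + N) (l := M + (N + 1 : ℕ)) (by push_cast; ring),
          show M + 1 + (N : ℤ) = M + (N + 1 : ℕ) by push_cast; ring, hsq,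
          zpow_add₀ hq₀ M, ← mul_assoc (q ^ (2 * N + 1 : ℤ)), e1]
        field_simp
        ring
    -- Here the two hypotheses at M + 1 match the summand only up to the telescoping term v(t-1) -
    -- v(t).
    · set v : ℤ → ℂ := fun t => qPoch (-q) q (M + 2 * t + 2) * q ^ (-t - 1) *
        (qFacInv (q ^ 2) (N - t) * qFacInv (q ^ 2) t * qFacInv (q ^ 2) (M + 1 + t)) with hv
      have hvs : Summable v := summable_of_eq_zero_outside 0 N
        (fun t ht => by simp [hv, qFacInv_of_neg hp₀ ht])
        (fun t ht => by simp [hv, qFacInv_of_neg hp₀ (sub_neg.2 ht)])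
      have key := ((((ih (M + 1)).2.mul_left q⁻¹).add ((ih (M + 1)).1.mul_left
        (1 + q ^ (M + 1)))).add (hasSum_telescope hvs)).mul_left
          (1 - (q ^ 2) ^ ((N + 1 : ℕ) : ℤ))⁻¹
      convert! key using 1
      · funext t
        rw [eq_inv_mul_iff_mul_eq₀ hb]
        simp only [hv]
        rw [qFacInv_rec hp₀ hp₁ (k := (N : ℤ) - t) (l := (N + 1 : ℕ) - t) (by push_cast; ring),
          qFacInv_rec hp₀ hp₁ (k := t - 1) (l := t) (by ring),
          show (N : ℤ) - (t - 1) = (N + 1 : ℕ) - t by push_cast; ring,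
          show M + 1 + (t - 1) = M + t by ring,
          qFacInv_rec hp₀ hp₁ (k := M + t) (l := M + 1 + t) (by ring),
          show M + 2 * (t - 1) + 2 = M + 2 * t by ring,
          show M + 1 + 2 * t - 1 = M + 2 * t by ring,
          show M + 1 + 2 * t = M + 2 * t + 1 by ring,
          qPoch_neg_self_rec hq₀ hq₁ (show M + 2 * t + 1 + 1 = M + 2 * t + 2 by ring),
          qPoch_neg_self_rec hq₀ hq₁ (show M + 2 * t + 1 = M + 2 * t + 1 by ring),
          show -(t - 1) - 1 = -t by ring,
          zpow_of_eq_add (c := ((N + 1 : ℕ) : ℤ)) hp₀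
            (show ((N + 1 : ℕ) : ℤ) = ((N + 1 : ℕ) - t) + t by ring), hsq t, hsq (M + 1 + t),
          show M + 2 * t + 2 = M + (t + t + 1 + 1) by ring,
          show M + 2 * t + 1 = M + (t + t + 1) by ring,
          show M + 1 + t = M + (t + 1) by ring]
        simp only [zpow_add₀ hq₀, zpow_sub₀ hq₀, zpow_neg, zpow_one]
        have hT : q ^ t ≠ 0 := zpow_ne_zero _ hq₀
        field_simp
        ring
      · rw [eq_inv_mul_iff_mul_eq₀ hb, mul_div_assoc', mul_div_cancel_left₀ _ hM',
          qFacInv_rec hq₀ hq₁ (k := N) (l := (N + 1 : ℕ)) (by push_cast; ring),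
          show M + 1 + (N : ℤ) = M + (N + 1 : ℕ) by push_cast; ring, hsq, ← eN]
        simp only [zpow_add₀ hq₀, zpow_neg, zpow_one]
        have hT : q ^ (N : ℤ) ≠ 0 := zpow_ne_zero _ hq₀
        field_simp
        ring

end FiniteSums

/-! ### Bailey lemma, change of base and Bailey lattice -/

section BaileyKernel

variable {q : ℂ}

lemma hasSum_sub_iff {f : ℤ → ℂ} {a : ℂ} (j : ℤ) :
    HasSum (fun t => f (t - j)) a ↔ HasSum f a :=
  (Equiv.subRight j).hasSum_iff

/-- The Bailey kernel `1 / ((q; q)_{n - j} (q; q)_{m + n + j})`. -/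
noncomputable def baileyKernel (q : ℂ) (m n j : ℤ) : ℂ := qFacInv q (n - j) * qFacInv q (m + n + j)

lemma baileyKernel_of_lt (hq₀ : q ≠ 0) {m n j : ℤ} (h : n < j) : baileyKernel q m n j = 0 := by
  rw [baileyKernel, qFacInv_of_neg hq₀ (by omega), zero_mul]

lemma baileyKernel_of_add_neg (hq₀ : q ≠ 0) {m n j : ℤ} (h : m + n + j < 0) :
    baileyKernel q m n j = 0 := by
  rw [baileyKernel, qFacInv_of_neg hq₀ h, mul_zero]

/-- The Bailey lemma, in terms of the Bailey kernel. -/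
lemma hasSum_bailey (hq₀ : q ≠ 0) (hq₁ : ‖q‖ < 1) (m n j : ℤ) :
    HasSum (fun k : ℤ => qFacInv q (n - k) * q ^ (k ^ 2 + m * k) * baileyKernel q m k j)
      (q ^ (j ^ 2 + m * j) * baileyKernel q m n j) := by
  rcases lt_or_ge n j with h | h
  · rw [baileyKernel_of_lt hq₀ h, mul_zero]
    convert! hasSum_zero using 2 with k
    rcases lt_or_ge n k with h' | h'
    · rw [qFacInv_of_neg hq₀ (by omega)]; ring
    · rw [baileyKernel_of_lt hq₀ (by omega)]; ring
  -- With k = t + j the claim is the Vandermonde sum with N = n - j and M = m + 2j.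
  · obtain ⟨N, rfl⟩ : ∃ N : ℕ, n = N + j := ⟨(n - j).toNat, by omega⟩
    have key := (hasSum_sub_iff j).2 (hasSum_qVandermonde hq₀ hq₁ N (m + 2 * j))
    convert! key.mul_left (q ^ (j ^ 2 + m * j)) using 1
    · funext k
      rw [zpow_of_eq_add hq₀ (show k ^ 2 + m * k =
        j ^ 2 + m * j + ((k - j) ^ 2 + (m + 2 * j) * (k - j)) by ring), baileyKernel,
        show m + 2 * j + (k - j) = m + k + j by ring, show (N : ℤ) - (k - j) = N + j - k by ring]
      ring
    · rw [baileyKernel]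
      ring_nf

/-- The change of base from `q ^ 2` to `q`, in terms of the Bailey kernel. -/
lemma hasSum_bailey_changeOfBase (hq₀ : q ≠ 0) (hq₁ : ‖q‖ < 1) (m n j : ℤ) :
    HasSum (fun k : ℤ => qFacInv (q ^ 2) (n - k) * (q ^ k * qPoch (-q) q (m + 2 * k - 1)) *
        baileyKernel (q ^ 2) m k j)
      (q ^ j / (1 + q ^ (m + 2 * j)) * baileyKernel q m n j) := by
  obtain ⟨hp₀, hp₁⟩ := sq_ne_zero_and_norm_sq_lt_one hq₀ hq₁
  rcases lt_or_ge n j with h | h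
  · rw [baileyKernel_of_lt hq₀ h, mul_zero]
    convert! hasSum_zero using 2 with k
    rcases lt_or_ge n k with h' | h'
    · rw [qFacInv_of_neg hp₀ (by omega)]; ring
    · rw [baileyKernel_of_lt hp₀ (by omega)]; ring
  · obtain ⟨N, rfl⟩ : ∃ N : ℕ, n = N + j := ⟨(n - j).toNat, by omega⟩
    have key := (hasSum_sub_iff j).2 (hasSum_changeOfBase hq₀ hq₁ N (m + 2 * j)).1
    convert! key.mul_left (q ^ j) using 1
    · funext k
      rw [zpow_of_eq_add hq₀ (show k = j + (k - j) by ring), baileyKernel,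
        show m + 2 * j + (k - j) = m + k + j by ring, show (N : ℤ) - (k - j) = N + j - k by ring,
        show m + 2 * j + 2 * (k - j) - 1 = m + 2 * k - 1 by ring]
      ring_nf
    · rw [baileyKernel]
      ring_nf

/-- The Bailey lemma times q^(-j): a factor q^(k-j) in the summand compensates exactly for the
lowered linear exponent. -/
lemma hasSum_bailey_lattice_aux (hq₀ : q ≠ 0) (hq₁ : ‖q‖ < 1) (m n j : ℤ) :
    HasSum (fun k : ℤ => qFacInv q (n - k) * q ^ (k ^ 2 + (m - 1) * k) *
        (q ^ (k - j) * baileyKernel q m k j))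
      (q ^ (j ^ 2 + (m - 1) * j) * baileyKernel q m n j) := by
  convert! (hasSum_bailey hq₀ hq₁ m n j).mul_left (q ^ (-j)) using 1
  · funext k
    rw [zpow_of_eq_add hq₀ (show k ^ 2 + m * k = k ^ 2 + (m - 1) * k + k by ring),
      zpow_of_eq_add hq₀ (show k - j = k + (-j) by ring)]
    ring
  · rw [zpow_of_eq_add hq₀ (show j ^ 2 + (m - 1) * j = -j + (j ^ 2 + m * j) by ring)]
    ring

/-- The step of the Bailey lattice, in terms of the Bailey kernel. -/
lemma hasSum_bailey_lattice (hq₀ : q ≠ 0) (hq₁ : ‖q‖ < 1) (m n j : ℤ) :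
    HasSum (fun k : ℤ => qFacInv q (n - k) * q ^ (k ^ 2 + (m - 1) * k) * baileyKernel q m k j)
      (q ^ (j ^ 2 + (m - 1) * j) * baileyKernel q m n j *
        (1 + q ^ (m + 2 * j) - q ^ (m + 2 * j) * q ^ (n - j))) := by
  -- Passing from (m, j) to (m-1, j+1) fixes the second factorial and costs 1 - q^(k-j). The kernel
  -- is this shifted kernel plus q^(k-j) times itself, and both pieces have known sums.
  have hk : ∀ k, baileyKernel q (m - 1) k (j + 1) = (1 - q ^ (k - j)) * baileyKernel q m k j := by
    intro k
    rw [baileyKernel, baileyKernel, show m - 1 + k + (j + 1) = m + k + j by ring,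
      qFacInv_rec hq₀ hq₁ (k := k - (j + 1)) (l := k - j) (by ring)]
    ring
  convert! (hasSum_bailey_lattice_aux hq₀ hq₁ m n j).add
    (hasSum_bailey hq₀ hq₁ (m - 1) n (j + 1)) using 1
  · funext k
    rw [hk]
    ring
  · rw [hk, zpow_of_eq_add hq₀ (show (j + 1) ^ 2 + (m - 1) * (j + 1) =
      j ^ 2 + (m - 1) * j + (m + 2 * j) by ring)]
    ring

end BaileyKernel

/-! ### q-binomial theorem and the unit Bailey pair -/

section Binomial

variable {u : ℂ}

/-- The `q`-binomial theorem in base `u ^ 2`. -/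
lemma hasSum_qBinomial_theorem (hu₀ : u ≠ 0) (hu₁ : ‖u‖ < 1) {z : ℂ} (hz : z ≠ 0) (N : ℕ) :
    HasSum (fun k : ℤ => (-1) ^ k * u ^ (k ^ 2 - k) * z ^ k *
        (qFacInv (u ^ 2) (N - k) * qFacInv (u ^ 2) k))
      ((∏ l ∈ Finset.range N, (1 - z * (u ^ 2) ^ l)) * qFacInv (u ^ 2) N) := by
  obtain ⟨hp₀, hp₁⟩ := sq_ne_zero_and_norm_sq_lt_one hu₀ hu₁
  have hsq : ∀ k : ℤ, (u ^ 2) ^ k = u ^ (2 * k) := fun k => by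
    rw [zpow_mul]; norm_cast
  induction N with
  | zero =>
    refine hasSum_of_eq_zero_of_ne_zero ?_ ?_
    · simp [qFacInv_zero hp₀ hp₁]
    · intro t ht
      simp [qFacInv_neg_mul_self hp₀ ht]
  | succ N ih =>
    have hb := one_sub_zpow_ne_zero hp₀ hp₁ (k := (N + 1 : ℕ)) (by positivity)
    have key := (ih.add ((hasSum_sub_one_iff.2 ih).mul_left
      (-z * (u ^ 2) ^ N))).mul_left (1 - (u ^ 2) ^ ((N + 1 : ℕ) : ℤ))⁻¹
    convert! key using 1
    · funext k
      rw [eq_inv_mul_iff_mul_eq₀ hb,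
        qFacInv_rec hp₀ hp₁ (k := (N : ℤ) - k) (l := (N + 1 : ℕ) - k) (by push_cast; ring),
        qFacInv_rec hp₀ hp₁ (k := k - 1) (l := k) (by ring),
        show (N : ℤ) - (k - 1) = (N + 1 : ℕ) - k by push_cast; ring,
        zpow_of_eq_add (c := ((N + 1 : ℕ) : ℤ)) hp₀
          (show ((N + 1 : ℕ) : ℤ) = ((N + 1 : ℕ) - k) + k by ring),
        zpow_sub_one₀ (by norm_num), zpow_sub_one₀ hz]
      have e1 : (u ^ 2) ^ N * u ^ ((k - 1) ^ 2 - (k - 1)) =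
          (u ^ 2) ^ (((N + 1 : ℕ) : ℤ) - k) * u ^ (k ^ 2 - k) := by
        rw [← zpow_natCast, hsq, hsq, ← zpow_add₀ hu₀, ← zpow_add₀ hu₀]
        congr 1
        push_cast
        ring
      have e2 : z * (z ^ k * z⁻¹) = z ^ k := by field_simp
      linear_combination (-((-1) ^ k * z ^ k * (qFacInv (u ^ 2) ((N + 1 : ℕ) - k) *
          ((1 - (u ^ 2) ^ k) * qFacInv (u ^ 2) k)))) * e1 -
        (-1) ^ k * (qFacInv (u ^ 2) ((N + 1 : ℕ) - k) *
          ((1 - (u ^ 2) ^ k) * qFacInv (u ^ 2) k)) * (u ^ 2) ^ N *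
            u ^ ((k - 1) ^ 2 - (k - 1)) * e2
    · rw [eq_inv_mul_iff_mul_eq₀ hb, qFacInv_rec hp₀ hp₁ (k := N) (l := (N + 1 : ℕ))
        (by push_cast; ring), Finset.prod_range_succ]
      ring

/-- Each factor 1 - u^(2l-2b) is -u^(2l-2b) times 1 - u^(2b-2l), which lowers the index of the
reciprocal factorial by one. For N > b both sides vanish; this gives the zero values of the
q-binomial coefficient. -/
lemma prod_one_sub_mul_qFacInv (hu₀ : u ≠ 0) (hu₁ : ‖u‖ < 1) (b : ℤ) (N : ℕ) :
    (∏ l ∈ Finset.range N, (1 - u ^ (-(2 * b)) * (u ^ 2) ^ l)) * qFacInv (u ^ 2) b =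
      (-1) ^ N * u ^ (N ^ 2 - N - 2 * b * N : ℤ) * qFacInv (u ^ 2) (b - N) := by
  obtain ⟨hp₀, hp₁⟩ := sq_ne_zero_and_norm_sq_lt_one hu₀ hu₁
  have hsq : ∀ k : ℤ, (u ^ 2) ^ k = u ^ (2 * k) := fun k => by
    rw [zpow_mul]; norm_cast
  induction N with
  | zero => simp
  | succ N ih =>
    rw [Finset.prod_range_succ, mul_right_comm, ih,
      qFacInv_rec hp₀ hp₁ (k := b - (N + 1 : ℕ)) (l := b - N) (by push_cast; ring), hsq,
      ← zpow_natCast (u ^ 2), hsq, ← zpow_add₀ hu₀,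
      zpow_of_eq_add hu₀ (show ((N + 1 : ℕ) ^ 2 - (N + 1 : ℕ) - 2 * b * (N + 1 : ℕ) : ℤ) =
        (N ^ 2 - N - 2 * b * N) + (-(2 * b) + 2 * N) by push_cast; ring)]
    have e1 : u ^ (2 * (b - N : ℤ)) * u ^ (-(2 * b) + 2 * N : ℤ) = 1 := by
      rw [← zpow_add₀ hu₀]
      ring_nf
      simp
    rw [pow_succ (-1 : ℂ)]
    generalize u ^ (N ^ 2 - N - 2 * b * N : ℤ) = W
    linear_combination (-((-1) ^ N * W * qFacInv (u ^ 2) (b - N))) * e1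

/-- The bilateral unit Bailey pair. -/
lemma hasSum_unit_bailey (hu₀ : u ≠ 0) (hu₁ : ‖u‖ < 1) (m n : ℤ) (hm : 0 ≤ m) :
    HasSum (fun j : ℤ => (-1) ^ j * u ^ (j ^ 2 - j) * baileyKernel (u ^ 2) m n j)
      ((-1) ^ n * u ^ (n ^ 2 - n) * qBinom (u ^ 2) (m + n) (m + 2 * n)) := by
  obtain ⟨hp₀, hp₁⟩ := sq_ne_zero_and_norm_sq_lt_one hu₀ hu₁
  rcases lt_or_ge (m + 2 * n) 0 with h | h
  · rw [qBinom, if_neg (by omega), mul_zero]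
    -- Now -m-n > n, so no j satisfies -m-n ≤ j ≤ n.
    convert! hasSum_zero using 2 with j
    rcases lt_or_ge n j with h' | h'
    · rw [baileyKernel_of_lt hp₀ h', mul_zero]
    · rw [baileyKernel_of_add_neg hp₀ (by omega), mul_zero]
  · obtain ⟨N, hN⟩ : ∃ N : ℕ, m + 2 * n = N := ⟨(m + 2 * n).toNat, by omega⟩
    -- Follows by adding m ≥ 0 to m + 2n ≥ 0; it allows division by the reciprocal factorial at b.
    have hb : 0 ≤ m + n := by omega
    obtain ⟨b, hbe⟩ : ∃ b, b = m + n := ⟨_, rfl⟩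
    have hm' : m = 2 * b - N := by omega
    have hn' : n = N - b := by omega
    rw [← hbe] at hb
    subst hm' hn'
    -- The argument z = u^(-2b) together with the shift of the index by b completes the square to
    -- u^(j²-j).
    have h1 := (hasSum_sub_iff (-b)).2 (hasSum_qBinomial_theorem hu₀ hu₁
      (zpow_ne_zero (-(2 * b)) hu₀) N)
    have hbne := qFacInv_ne_zero hp₀ hp₁ hb
    convert! h1.mul_left ((-1) ^ b * u ^ (b ^ 2 + b)) using 1
    · funext j
      have e1 : u ^ (b ^ 2 + b) * (u ^ ((j + b) ^ 2 - (j + b)) * u ^ (-(2 * b) * (j + b))) =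
          u ^ (j ^ 2 - j) := by
        rw [← zpow_add₀ hu₀, ← zpow_add₀ hu₀]
        congr 1
        ring
      have e2 : ((-1 : ℂ) ^ b) * (-1) ^ b = 1 := by rw [← mul_zpow]; simp
      rw [sub_neg_eq_add, ← zpow_mul, baileyKernel, ← e1,
        zpow_add₀ (show (-1 : ℂ) ≠ 0 by norm_num),
        show 2 * b - N + (N - b) + j = j + b by ring, show (N : ℤ) - b - j = N - (j + b) by ring]
      linear_combination (-((-1) ^ j * u ^ (b ^ 2 + b) * (u ^ ((j + b) ^ 2 - (j + b)) *
        u ^ (-(2 * b) * (j + b))) * (qFacInv (u ^ 2) (N - (j + b)) *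
          qFacInv (u ^ 2) (j + b)))) * e2
    · have h2 := prod_one_sub_mul_qFacInv hu₀ hu₁ b N
      rw [← eq_div_iff hbne] at h2
      have e3 : u ^ (b ^ 2 + b) * u ^ (N ^ 2 - N - 2 * b * N : ℤ) =
          u ^ ((N - b) ^ 2 - (N - b) : ℤ) := by
        rw [← zpow_add₀ hu₀]
        congr 1
        ring
      have e4 : (-1 : ℂ) ^ (N - b : ℤ) = (-1) ^ b * (-1) ^ N := by
        rw [zpow_sub₀ (by norm_num), zpow_natCast, div_eq_mul_inv, ← inv_zpow]
        norm_num
        ring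
      have e5 : qBinom (u ^ 2) (2 * b - N + (N - b)) (2 * b - N + 2 * (N - b)) =
          qFacInv (u ^ 2) (b - N) / qFacInv (u ^ 2) b * qFacInv (u ^ 2) N := by
        rw [show 2 * b - N + (N - b) = b by ring, show 2 * b - N + 2 * (N - b) = (N : ℤ) by ring,
          qBinom]
        split_ifs with hc
        · simp only [qFacInv]
          field_simp
        · rw [qFacInv_of_neg hp₀ (k := b - N) (by omega)]
          ring
      rw [h2, e5, e4, ← e3]
      ring

end Binomial

/-! ### Jacobi triple product -/

section TripleProduct

lemma summable_zpow_abs {ρ : ℝ} (h₀ : 0 < ρ) (h₁ : ρ < 1) : Summable fun j : ℤ => ρ ^ |j| := by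
  refine Summable.of_nat_of_neg ?_ ?_ <;>
  simpa using summable_geometric_of_lt_one h₀.le h₁

lemma summable_zpow_quadratic {ρ : ℝ} (h₀ : 0 < ρ) (h₁ : ρ < 1) {a : ℤ} (ha : 1 ≤ a) (b : ℤ) :
    Summable fun j : ℤ => ρ ^ (a * j ^ 2 + b * j) := by
  -- Since X² - BX + B² ≥ 0 with X = |j| and B = |b| + 1, the exponent is at least |j| - B².
  refine Summable.of_nonneg_of_le (fun j => (zpow_pos h₀ _).le) (fun j => ?_)
    ((summable_zpow_abs h₀ h₁).mul_left (ρ ^ (-(|b| + 1) ^ 2)))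
  rw [← zpow_add₀ h₀.ne']
  apply zpow_le_zpow_right_of_le_one₀ h₀ h₁.le
  have h2 : -(|b| * |j|) ≤ b * j := by rw [← abs_mul]; exact neg_abs_le _
  nlinarith [sq_abs j, mul_nonneg (sub_nonneg.2 ha) (sq_nonneg j), sq_nonneg (|j| - (|b| + 1)),
    abs_nonneg j, abs_nonneg b, mul_nonneg (abs_nonneg j) (abs_nonneg b)]

variable {q u : ℂ}

/-- Reverse the order of the factors and extract the second term of each one. -/
lemma prod_one_sub_reflect (hu₀ : u ≠ 0) {z : ℂ} (hz : z ≠ 0) (n : ℕ) :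
    ∏ l ∈ Finset.range n, (1 - z * u ^ (-(2 * n) : ℤ) * (u ^ 2) ^ l) =
      (-1) ^ n * u ^ (-(n ^ 2 + n) : ℤ) * z ^ n *
        ∏ l ∈ Finset.range n, (1 - u ^ 2 / z * (u ^ 2) ^ l) := by
  have hsq : ∀ k : ℕ, (u ^ 2) ^ k = u ^ (2 * k : ℤ) := fun k => by
    rw [zpow_mul]; norm_cast
  have h : ∏ l ∈ Finset.range n, (1 - z * u ^ (-(2 * n) : ℤ) * (u ^ 2) ^ l) =
      ∏ l ∈ Finset.range n, (1 - z * u ^ (-(2 * l + 2) : ℤ)) := by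
    rw [← Finset.prod_range_reflect]
    refine Finset.prod_congr rfl fun l hl => ?_
    rw [mul_assoc, hsq, ← zpow_add₀ hu₀]
    have := Finset.mem_range.1 hl
    congr 3
    omega
  rw [h]
  clear h
  induction n with
  | zero => simp
  | succ n ih =>
    rw [Finset.prod_range_succ, Finset.prod_range_succ, ih, hsq,
      zpow_of_eq_add hu₀ (show (-((n + 1 : ℕ) ^ 2 + (n + 1 : ℕ)) : ℤ) =
        -(n ^ 2 + n) + (-(2 * n + 2)) by push_cast; ring)]
    have e1 : u ^ (-(2 * n + 2) : ℤ) * (u ^ 2 * u ^ (2 * n : ℤ)) = 1 := by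
      rw [← zpow_natCast u 2, ← zpow_add₀ hu₀, ← zpow_add₀ hu₀]
      ring_nf
      simp
    have e2 : u ^ 2 / z * u ^ (2 * n : ℤ) = u ^ 2 * u ^ (2 * n : ℤ) * z⁻¹ := by ring
    have e3 : z * z⁻¹ = 1 := mul_inv_cancel₀ hz
    rw [e2, pow_succ (-1 : ℂ), pow_succ z]
    generalize ∏ l ∈ Finset.range n, (1 - u ^ 2 / z * (u ^ 2) ^ l) = P
    generalize u ^ (-(n ^ 2 + n) : ℤ) = W
    generalize u ^ (-(2 * n + 2) : ℤ) = V at *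
    generalize u ^ 2 * u ^ (2 * n : ℤ) = T at *
    linear_combination (-((-1) ^ n * W * z ^ n * P)) * (e1 * z * z⁻¹ + e3)

/-- The finite form of the Jacobi triple product identity. -/
lemma hasSum_finite_tripleProduct (hu₀ : u ≠ 0) (hu₁ : ‖u‖ < 1) {z : ℂ} (hz : z ≠ 0) (n : ℕ) :
    HasSum (fun j : ℤ => (-1) ^ j * u ^ (j ^ 2 - j) * z ^ j *
        (qFacInv (u ^ 2) (n - j) * qFacInv (u ^ 2) (n + j)))
      ((∏ l ∈ Finset.range n, (1 - z * (u ^ 2) ^ l)) *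
        (∏ l ∈ Finset.range n, (1 - u ^ 2 / z * (u ^ 2) ^ l)) *
        qFacInv (u ^ 2) (2 * n : ℕ)) := by
  have hw : z * u ^ (-(2 * n) : ℤ) ≠ 0 := mul_ne_zero hz (zpow_ne_zero _ hu₀)
  -- The q-binomial theorem with 2n factors, recentred so that j runs symmetrically over -n ≤ j ≤ n.
  have h1 := (hasSum_sub_iff (-n : ℤ)).2 (hasSum_qBinomial_theorem hu₀ hu₁ hw (2 * n))
  have hne : (-1 : ℂ) ≠ 0 := by norm_num
  convert! h1.mul_left ((-1) ^ n * u ^ (n ^ 2 + n : ℤ) * z ^ (-n : ℤ)) using 1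
  · funext j
    have e1 : u ^ (n ^ 2 + n : ℤ) * (u ^ ((j + n) ^ 2 - (j + n) : ℤ) *
        u ^ (-(2 * n) * (j + n) : ℤ)) = u ^ (j ^ 2 - j) := by
      rw [← zpow_add₀ hu₀, ← zpow_add₀ hu₀]
      congr 1
      ring
    have e2 : ((-1 : ℂ) ^ n) * (-1) ^ n = 1 := by rw [← mul_pow]; simp
    have e3 : z ^ (-n : ℤ) * z ^ (j + n) = z ^ j := by
      rw [← zpow_add₀ hz]
      congr 1
      ring
    rw [sub_neg_eq_add, mul_zpow, ← zpow_mul, ← e1, ← e3, zpow_add₀ hne, zpow_natCast,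
      show ((2 * n : ℕ) : ℤ) - (j + n) = n - j by push_cast; ring, add_comm (n : ℤ) j]
    generalize u ^ (n ^ 2 + n : ℤ) = A
    generalize u ^ ((j + n) ^ 2 - (j + n) : ℤ) = B
    generalize u ^ (-(2 * n) * (j + n) : ℤ) = D
    linear_combination (-((-1) ^ j * (A * (B * D)) * (z ^ (-n : ℤ) * z ^ (j + n)) *
      (qFacInv (u ^ 2) (n - j) * qFacInv (u ^ 2) (j + n)))) * e2
  · rw [two_mul n, Finset.prod_range_add, prod_one_sub_reflect hu₀ hz]
    have e0 : ∀ l, z * u ^ (-(2 * n) : ℤ) * (u ^ 2) ^ (n + l) = z * (u ^ 2) ^ l := by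
      intro l
      have : u ^ (-(2 * n) : ℤ) * (u ^ 2) ^ n = 1 := by
        rw [← pow_mul, ← zpow_natCast, ← zpow_add₀ hu₀]
        push_cast
        simp
      rw [pow_add]
      linear_combination (z * (u ^ 2) ^ l) * this
    simp only [e0]
    have e1 : u ^ (n ^ 2 + n : ℤ) * u ^ (-(n ^ 2 + n) : ℤ) = 1 := by
      rw [← zpow_add₀ hu₀]
      simp
    have e2 : ((-1 : ℂ) ^ n) * (-1) ^ n = 1 := by rw [← mul_pow]; simp
    have e3 : z ^ (-n : ℤ) * z ^ n = 1 := by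
      rw [← zpow_natCast, ← zpow_add₀ hz]
      simp
    generalize (∏ l ∈ Finset.range n, (1 - z * (u ^ 2) ^ l)) = X
    generalize (∏ l ∈ Finset.range n, (1 - u ^ 2 / z * (u ^ 2) ^ l)) = Y
    generalize u ^ (n ^ 2 + n : ℤ) = A at *
    generalize u ^ (-(n ^ 2 + n) : ℤ) = B at *
    linear_combination (-(X * Y * qFacInv (u ^ 2) ((n + n : ℕ) : ℤ))) *
      (e1 * ((-1) ^ n * (-1) ^ n) * (z ^ (-n : ℤ) * z ^ n) + e2 * (z ^ (-n : ℤ) * z ^ n) + e3)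

lemma tendsto_qFacInv_of_tendsto (hq₀ : q ≠ 0) (hq₁ : ‖q‖ < 1) {f : ℕ → ℤ}
    (hf : Tendsto f atTop atTop) :
    Tendsto (fun n => qFacInv q (f n)) atTop (𝓝 (qPochInf q q)⁻¹) :=
  (tendsto_qFacInv hq₀ hq₁).comp hf

lemma tendsto_natCast_add_int (j : ℤ) : Tendsto (fun n : ℕ => (n : ℤ) + j) atTop atTop :=
  tendsto_atTop_add_const_right _ _ tendsto_natCast_atTop_atTop

/-- The Jacobi triple product identity. -/
lemma hasSum_tripleProduct (hq₀ : q ≠ 0) (hq₁ : ‖q‖ < 1) {r : ℕ} (hr : r ≠ 0) (c : ℤ) :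
    HasSum (fun j : ℤ => (-1) ^ j * q ^ (r * j ^ 2 + c * j))
      (qPochInf₃ (q ^ (2 * r)) (q ^ (r + c)) (q ^ (r - c)) (q ^ (2 * r))) := by
  -- With these u and z, u^(j²-j) z^j = q^(rj²+cj), so the finite form applies and n → ∞ gives the
  -- claim.
  obtain ⟨u, hu⟩ : ∃ u, u = q ^ r := ⟨_, rfl⟩
  obtain ⟨z, hz⟩ : ∃ z, z = q ^ (r + c) := ⟨_, rfl⟩
  have hu₀ : u ≠ 0 := hu ▸ pow_ne_zero _ hq₀
  have hz₀ : z ≠ 0 := hz ▸ zpow_ne_zero _ hq₀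
  have hu₁ : ‖u‖ < 1 := by rw [hu, norm_pow]; exact pow_lt_one₀ (norm_nonneg _) hq₁ hr
  obtain ⟨hp₀, hp₁⟩ := sq_ne_zero_and_norm_sq_lt_one hu₀ hu₁
  have hp : q ^ (2 * r) = u ^ 2 := by rw [hu, ← pow_mul, mul_comm]
  have hzc : q ^ (r - c) = u ^ 2 / z := by
    rw [eq_div_iff hz₀, hz, ← hp, ← zpow_add₀ hq₀, ← zpow_natCast]
    congr 1
    push_cast
    ring
  have hterm : ∀ j : ℤ, q ^ (r * j ^ 2 + c * j) = u ^ (j ^ 2 - j) * z ^ j := by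
    intro j
    rw [hu, hz, ← zpow_natCast, ← zpow_mul, ← zpow_mul, ← zpow_add₀ hq₀]
    congr 1
    ring
  have hs : Summable fun j : ℤ => ‖q‖ ^ (r * j ^ 2 + c * j) :=
    summable_zpow_quadratic (norm_pos_iff.2 hq₀) hq₁ (by omega) c
  have hnorm : ∀ j : ℤ, ‖(-1) ^ j * q ^ (r * j ^ 2 + c * j)‖ = ‖q‖ ^ (r * j ^ 2 + c * j) := by
    intro j
    rw [norm_mul, norm_zpow, norm_zpow, norm_neg, norm_one, one_zpow, one_mul]
  have hs' : Summable fun j : ℤ => (-1) ^ j * q ^ (r * j ^ 2 + c * j) :=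
    Summable.of_norm (by simpa only [hnorm] using hs)
  set P := qPochInf (u ^ 2) (u ^ 2) with hP
  have hP₀ : P ≠ 0 := qPochInf_self_ne_zero hp₀ hp₁
  obtain ⟨C, hC0, hC⟩ := exists_norm_qFacInv_le hp₀ hp₁
  have lim1 : Tendsto (fun n : ℕ => ∑' j : ℤ, (-1) ^ j * q ^ (r * j ^ 2 + c * j) *
      (qFacInv (u ^ 2) (n - j) * qFacInv (u ^ 2) (n + j))) atTop
      (𝓝 (∑' j : ℤ, (-1) ^ j * q ^ (r * j ^ 2 + c * j) * (P⁻¹ * P⁻¹))) := by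
    refine tendsto_tsum_of_dominated_convergence (hs.mul_right (C * C)) (fun j => ?_)
      (Eventually.of_forall fun n j => ?_)
    · exact ((tendsto_qFacInv_of_tendsto hp₀ hp₁ (tendsto_natCast_add_int (-j))).mul
        (tendsto_qFacInv_of_tendsto hp₀ hp₁ (tendsto_natCast_add_int j))).const_mul _
    · rw [norm_mul, hnorm, norm_mul]
      gcongr
      · exact hC _
      · exact hC _
  have lim2 : Tendsto (fun n : ℕ => ∑' j : ℤ, (-1) ^ j * q ^ (r * j ^ 2 + c * j) *
      (qFacInv (u ^ 2) (n - j) * qFacInv (u ^ 2) (n + j))) atTop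
      (𝓝 (qPochInf z (u ^ 2) * qPochInf (u ^ 2 / z) (u ^ 2) * P⁻¹)) := by
    have := ((tendsto_prod_qPochInf z hp₁).mul (tendsto_prod_qPochInf (u ^ 2 / z) hp₁)).mul
      (tendsto_qFacInv_of_tendsto hp₀ hp₁ (f := fun n => ((2 * n : ℕ) : ℤ))
        (tendsto_natCast_atTop_atTop.comp (tendsto_id.const_mul_atTop' two_pos)))
    refine this.congr fun n => ?_
    rw [← (hasSum_finite_tripleProduct hu₀ hu₁ hz₀ n).tsum_eq]
    simp only [hterm, mul_assoc]
  have heq := tendsto_nhds_unique lim1 lim2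
  rw [tsum_mul_right] at heq
  convert! hs'.hasSum using 1
  rw [qPochInf₃, hp, hzc, ← hz, ← hP]
  field_simp at heq
  rw [heq]

end TripleProduct

/-! ### The bounded chain and its evaluation -/

section Chain

variable {q : ℂ}

/-- The weight of the largest variable of a chain in which the `i` largest variables carry the
additional factor `q ^ (-k)`. -/
noncomputable def chainWeight (q : ℂ) (m i : ℕ) (k : ℤ) : ℂ :=
  q ^ (k ^ 2 + (if 0 < i then (m : ℤ) - 1 else m) * k)

/-- The factor of the multisum that depends on the smallest variable only. -/
noncomputable def chainEnd (q : ℂ) (m : ℕ) (k : ℤ) : ℂ :=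
  q ^ k ^ 2 * qPoch (-q) q (m + 2 * k - 1) * (-1) ^ k * qBinom (q ^ 2) (m + k) (m + 2 * k)

/-- The summand of the multisum with an additional variable `n` that bounds the chain. -/
noncomputable def chainTerm (q : ℂ) (m : ℕ) : (p i : ℕ) → (n : ℤ) → (Fin (p + 1) → ℤ) → ℂ
  | 0, _, n, s => qFacInv (q ^ 2) (n - s 0) * chainEnd q m (s 0)
  | p + 1, i, n, s => qFacInv q (n - s 0) * chainWeight q m i (s 0) *
      chainTerm q m p (i - 1) (s 0) (Fin.tail s)

/-- The contribution of index `j` to the sum over all chains bounded by `n`. -/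
noncomputable def chainKernel (q : ℂ) (m p i : ℕ) (n j : ℤ) : ℂ :=
  (-1) ^ j * q ^ j ^ 2 / (1 + q ^ (m + 2 * j)) *
    q ^ ((p - i) * (j ^ 2 + m * j) + i * (j ^ 2 + (m - 1) * j)) * baileyKernel q m n j *
    (∑ k ∈ Finset.range (i + 1), (q ^ (m + 2 * j)) ^ k -
      q ^ (m + 2 * j) * q ^ (n - j) * ∑ k ∈ Finset.range i, (q ^ (m + 2 * j)) ^ k)

lemma chainKernel_of_notMem (hq₀ : q ≠ 0) (m p i : ℕ) {n j : ℤ}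
    (h : j ∉ Finset.Icc (-m - n) n) : chainKernel q m p i n j = 0 := by
  have : baileyKernel q m n j = 0 := by
    rw [Finset.mem_Icc, not_and_or, not_le, not_le] at h
    rcases h with h | h
    · exact baileyKernel_of_add_neg hq₀ (by omega)
    · exact baileyKernel_of_lt hq₀ h
  rw [chainKernel, this]
  ring

/-- The unit Bailey pair in base q², written over a range of j that does not depend on s, so that
the sums over j and s can be exchanged freely. -/
lemma chainEnd_eq_sum (hq₀ : q ≠ 0) (hq₁ : ‖q‖ < 1) (m : ℕ) {n s : ℤ} (h : s ≤ n) :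
    chainEnd q m s = q ^ s * qPoch (-q) q (m + 2 * s - 1) * ∑ j ∈ Finset.Icc (-m - n) n,
      (-1) ^ j * q ^ (j ^ 2 - j) * baileyKernel (q ^ 2) m s j := by
  have hp₀ := (sq_ne_zero_and_norm_sq_lt_one hq₀ hq₁).1
  rw [(hasSum_sum_of_ne_finset_zero fun j hj => ?_).unique
    (hasSum_unit_bailey hq₀ hq₁ m s (by omega)), chainEnd,
    zpow_of_eq_add hq₀ (show s ^ 2 = s + (s ^ 2 - s) by ring)]
  · ring
  · rw [Finset.mem_Icc, not_and_or, not_le, not_le] at hj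
    rcases hj with h' | h'
    · rw [baileyKernel_of_add_neg hp₀ (by omega), mul_zero]
    · rw [baileyKernel_of_lt hp₀ (by omega), mul_zero]

lemma hasSum_chainEnd (hq₀ : q ≠ 0) (hq₁ : ‖q‖ < 1) (m : ℕ) (n : ℤ) :
    HasSum (fun s : ℤ => qFacInv (q ^ 2) (n - s) * chainEnd q m s)
      (∑ j ∈ Finset.Icc (-m - n) n, chainKernel q m 0 0 n j) := by
  have hp₀ := (sq_ne_zero_and_norm_sq_lt_one hq₀ hq₁).1
  have key := hasSum_sum (s := Finset.Icc (-m - n) n) fun j _ =>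
    (hasSum_bailey_changeOfBase hq₀ hq₁ m n j).mul_left ((-1) ^ j * q ^ (j ^ 2 - j))
  convert! key using 1
  · funext s
    rcases lt_or_ge n s with h | h
    · simp [qFacInv_of_neg hp₀ (sub_neg.2 h)]
    · rw [chainEnd_eq_sum hq₀ hq₁ m h, Finset.mul_sum, Finset.mul_sum]
      refine Finset.sum_congr rfl fun j _ => ?_
      ring
  · refine Finset.sum_congr rfl fun j _ => ?_
    simp only [chainKernel, zpow_of_eq_add hq₀ (show j ^ 2 = (j ^ 2 - j) + j by ring)]
    simp
    ring

/-- One variable is summed out. In the lattice case let A = 1 + ... + x^i and B = 1 + ... + x^(i-1),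
with i as in the `succ` branch. The bracket A - x q^(s-j) B becomes A(1 + x - x q^(n-j)) - xB, and A
+ x(A - B) = 1 + ... + x^(i+1), so its shape is preserved. When i = 0, the truncated `i - 1` is
again 0. -/
lemma hasSum_chainKernel (hq₀ : q ≠ 0) (hq₁ : ‖q‖ < 1) (m p i : ℕ) (n j : ℤ) :
    HasSum (fun s : ℤ => qFacInv q (n - s) * chainWeight q m i s *
      chainKernel q m p (i - 1) s j) (chainKernel q m (p + 1) i n j) := by
  cases i with
  | zero =>
    convert! (hasSum_bailey hq₀ hq₁ m n j).mul_left ((-1) ^ j * q ^ j ^ 2 /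
      (1 + q ^ (m + 2 * j)) * q ^ (p * (j ^ 2 + m * j))) using 1
    · funext s
      simp [chainWeight, chainKernel]
      ring
    · simp [chainKernel, add_mul, zpow_add₀ hq₀]
      ring
  | succ i =>
    have h1 := ((hasSum_bailey_lattice hq₀ hq₁ m n j).mul_left
      (∑ k ∈ Finset.range (i + 1), (q ^ (m + 2 * j)) ^ k)).sub
      ((hasSum_bailey_lattice_aux hq₀ hq₁ m n j).mul_left
        (q ^ (m + 2 * j) * ∑ k ∈ Finset.range i, (q ^ (m + 2 * j)) ^ k))
    convert! h1.mul_left ((-1) ^ j * q ^ j ^ 2 / (1 + q ^ (m + 2 * j)) *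
      q ^ ((p - i) * (j ^ 2 + m * j) + i * (j ^ 2 + (m - 1) * j))) using 1
    · funext s
      simp only [chainWeight, chainKernel, Nat.add_sub_cancel, Nat.succ_pos, if_true]
      ring
    · rw [chainKernel, zpow_of_eq_add hq₀ (show
        ((p + 1 : ℕ) - (i + 1 : ℕ)) * (j ^ 2 + m * j) + (i + 1 : ℕ) * (j ^ 2 + (m - 1) * j) =
        ((p - i) * (j ^ 2 + m * j) + i * (j ^ 2 + (m - 1) * j)) + (j ^ 2 + (m - 1) * j) by
          push_cast; ring), Finset.sum_range_succ _ (i + 1), Finset.sum_range_succ _ i]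
      ring

lemma hasSum_chain_step (hq₀ : q ≠ 0) (hq₁ : ‖q‖ < 1) (m p i : ℕ) (n : ℤ) :
    HasSum (fun s : ℤ => qFacInv q (n - s) * chainWeight q m i s *
        ∑ j ∈ Finset.Icc (-m - s) s, chainKernel q m p (i - 1) s j)
      (∑ j ∈ Finset.Icc (-m - n) n, chainKernel q m (p + 1) i n j) := by
  have key := hasSum_sum (s := Finset.Icc (-m - n) n) fun j _ =>
    hasSum_chainKernel hq₀ hq₁ m p i n j
  convert! key using 1
  funext s
  rcases lt_or_ge n s with h | h
  · simp [qFacInv_of_neg hq₀ (sub_neg.2 h)]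
  · rw [← Finset.mul_sum]
    congr 1
    -- As s ≤ n, the range of j for s lies in the one for n, and the kernel vanishes on the
    -- difference.
    refine Finset.sum_subset (Finset.Icc_subset_Icc (by omega) h) fun j _ hj => ?_
    exact chainKernel_of_notMem hq₀ m p _ hj

lemma norm_chainWeight_summable (hq₀ : q ≠ 0) (hq₁ : ‖q‖ < 1) (m i : ℕ) :
    Summable fun k => ‖chainWeight q m i k‖ := by
  simp only [chainWeight, norm_zpow]
  simpa using summable_zpow_quadratic (norm_pos_iff.2 hq₀) hq₁ le_rfl
    (if 0 < i then (m : ℤ) - 1 else m)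

lemma chainEnd_eq_zero_of_lt (m : ℕ) {k : ℤ} (h : m + 2 * k < 0) : chainEnd q m k = 0 := by
  rw [chainEnd, qBinom, if_neg (by omega), mul_zero]

lemma chainEnd_eq_zero_of_pos (m : ℕ) {k : ℤ} (h : 0 < k) : chainEnd q m k = 0 := by
  rw [chainEnd, qBinom, if_neg (by omega), mul_zero]

/-- The bound is uniform in n, as the later limit requires: reciprocal factorials are bounded, the
weights decay quadratically in the exponent, and the last factor lives on -m/2 ≤ k ≤ 0. -/
lemma exists_chainTerm_bound (hq₀ : q ≠ 0) (hq₁ : ‖q‖ < 1) (m p i : ℕ) :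
    ∃ B : (Fin (p + 1) → ℤ) → ℝ, Summable B ∧ ∀ n s, ‖chainTerm q m p i n s‖ ≤ B s := by
  obtain ⟨hp₀, hp₁⟩ := sq_ne_zero_and_norm_sq_lt_one hq₀ hq₁
  induction p generalizing i with
  | zero =>
    obtain ⟨C, hC0, hC⟩ := exists_norm_qFacInv_le hp₀ hp₁
    refine ⟨fun s => C * ‖chainEnd q m (s 0)‖, Summable.mul_left C ?_, fun n s => ?_⟩
    · refine ((Equiv.funUnique (Fin 1) ℤ).summable_iff
        (f := fun k => ‖chainEnd q m k‖)).2 ?_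
      refine summable_of_ne_finset_zero (s := Finset.Icc (-m) 0) fun k hk => ?_
      rw [Finset.mem_Icc, not_and_or, not_le, not_le] at hk
      rw [norm_eq_zero]
      rcases hk with h | h
      · exact chainEnd_eq_zero_of_lt m (by omega)
      · exact chainEnd_eq_zero_of_pos m h
    · simp only [chainTerm, norm_mul]
      gcongr
      exact hC _
  | succ p ih =>
    obtain ⟨C, hC0, hC⟩ := exists_norm_qFacInv_le hq₀ hq₁
    obtain ⟨B, hB, hB'⟩ := ih (i - 1)
    refine ⟨fun s => C * ‖chainWeight q m i (s 0)‖ * B (Fin.tail s), ?_, fun n s => ?_⟩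
    · refine (Fin.consEquiv fun _ : Fin (p + 1 + 1) => ℤ).summable_iff.1 ?_
      have hB0 : ∀ s, 0 ≤ B s := fun s => (norm_nonneg _).trans (hB' 0 s)
      have := ((norm_chainWeight_summable hq₀ hq₁ m i).mul_left C).mul_of_nonneg hB
        (fun _ => by positivity) hB0
      refine this.congr fun x => ?_
      simp [Fin.consEquiv]
    · simp only [chainTerm, norm_mul]
      gcongr
      · exact hC _
      · exact hB' _ _

lemma hasSum_chainTerm (hq₀ : q ≠ 0) (hq₁ : ‖q‖ < 1) (m p i : ℕ) (hi : i ≤ p) (n : ℤ) :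
    HasSum (chainTerm q m p i n) (∑ j ∈ Finset.Icc (-m - n) n, chainKernel q m p i n j) := by
  induction p generalizing i n with
  | zero =>
    obtain rfl : i = 0 := by omega
    exact ((Equiv.funUnique (Fin 1) ℤ).hasSum_iff
      (f := fun k => qFacInv (q ^ 2) (n - k) * chainEnd q m k)).2 (hasSum_chainEnd hq₀ hq₁ m n)
  | succ p ih =>
    obtain ⟨B, hB, hB'⟩ := exists_chainTerm_bound hq₀ hq₁ m (p + 1) i
    have hs : Summable (chainTerm q m (p + 1) i n) := Summable.of_norm_bounded hB (hB' n)
    have h1 := (Fin.consEquiv fun _ : Fin (p + 1 + 1) => ℤ).hasSum_iff.2 hs.hasSum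
    -- The largest variable is held fixed; it serves as the bound of the remaining chain.
    have h2 := h1.prod_fiberwise (g := fun a => qFacInv q (n - a) * chainWeight q m i a *
        ∑ j ∈ Finset.Icc (-m - a) a, chainKernel q m p (i - 1) a j) fun a => by
      convert! (ih (i - 1) (by omega) a).mul_left
        (qFacInv q (n - a) * chainWeight q m i a) using 1
    rw [(hasSum_chain_step hq₀ hq₁ m p i n).unique h2]
    exact hs.hasSum

end Chain

/-! ### From the chain to the multisum, and the limit n → ∞ -/

section Multisum

variable {q : ℂ}

lemma multisumExponent_succ (m p i : ℕ) (s : Fin (p + 3) → ℤ) :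
    multisumExponent m (p + 3) i s = (s 0 ^ 2 + (if 0 < i then (m : ℤ) - 1 else m) * s 0) +
      multisumExponent m (p + 2) (i - 1) (Fin.tail s) := by
  simp only [multisumExponent, Finset.sum_filter, Fin.sum_univ_succ (n := p + 2), Fin.val_succ,
    Fin.val_zero, Fin.tail]
  have e1 : ∀ j : Fin (p + 2), (j.val + 1 + 1 < p + 3) = (j.val + 1 < p + 2) := fun j => by
    simp
  have e2 : ∀ j : Fin (p + 2), (j.val + 1 < i) = (j.val < i - 1) := fun j => by
    rw [eq_iff_iff]; omega
  simp only [e1, e2]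
  by_cases h : 0 < i <;> simp only [show 0 + 1 < p + 3 by omega, h, if_true, if_false] <;> ring

lemma multisumTerm_succ (hq₀ : q ≠ 0) (m p i : ℕ) (hr : 2 ≤ p + 2) (hr' : 2 ≤ p + 3)
    (s : Fin (p + 3) → ℤ) :
    multisumTerm q m (p + 3) i hr' s = chainWeight q m i (s 0) * qFacInv q (s 0 - s 1) *
      multisumTerm q m (p + 2) (i - 1) hr (Fin.tail s) := by
  have e : (∏ j : Fin (p + 3 - 2), qPoch q q (s ⟨j, by omega⟩ - s ⟨j + 1, by omega⟩)) =
      qPoch q q (s 0 - s 1) * ∏ j : Fin (p + 2 - 2), qPoch q q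
        (Fin.tail s ⟨j, by omega⟩ - Fin.tail s ⟨j + 1, by omega⟩) :=
    Fin.prod_univ_succ (n := p) fun j : Fin (p + 1) =>
      qPoch q q (s ⟨j, by omega⟩ - s ⟨j + 1, by omega⟩)
  simp only [multisumTerm]
  rw [e, multisumExponent_succ, zpow_add₀ hq₀, ← chainWeight, qFacInv]
  have e1 : Fin.tail s ⟨p + 2 - 1, by omega⟩ = s ⟨p + 3 - 1, by omega⟩ := rfl
  have e2 : Fin.tail s ⟨p + 2 - 2, by omega⟩ = s ⟨p + 3 - 2, by omega⟩ := rfl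
  rw [e1, e2]
  simp only [div_eq_mul_inv, mul_inv]
  ring

/-- The auxiliary variable enters through one factor only, which equals 1 at n = s_1. Bounds and
support of the multisum are thus read off from the chain. The condition on i keeps the linear
exponent away from the smallest variable. -/
lemma chainTerm_eq_mul_multisumTerm (hq₀ : q ≠ 0) (m p i : ℕ) (hi : i < p + 2)
    (hr : 2 ≤ p + 2) (n : ℤ) (s : Fin (p + 2) → ℤ) :
    chainTerm q m (p + 1) i n s = qFacInv q (n - s 0) * multisumTerm q m (p + 2) i hr s := by
  induction p generalizing i n with
  | zero =>
    have e : multisumExponent m 2 i s =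
        (s 0 ^ 2 + (if 0 < i then (m : ℤ) - 1 else m) * s 0) + s 1 ^ 2 := by
      simp only [multisumExponent, Finset.sum_filter, Fin.sum_univ_two]
      simp only [Fin.val_zero, Fin.val_one, if_neg (show ¬ 1 < i by omega)]
      norm_num
      split_ifs <;> ring
    have e0 : s ⟨0 + 2 - 1, by omega⟩ = s 1 := rfl
    have e1 : s ⟨0 + 2 - 2, by omega⟩ = s 0 := rfl
    have e2 : Fin.tail s 0 = s 1 := rfl
    have e3 : (∏ j : Fin (0 + 2 - 2), qPoch q q (s ⟨j, by omega⟩ - s ⟨j + 1, by omega⟩)) = 1 :=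
      Fin.prod_univ_zero _
    simp only [chainTerm, chainEnd, multisumTerm]
    rw [e0, e1, e2, e3, e, zpow_add₀ hq₀, ← chainWeight, qFacInv, qFacInv]
    ring
  | succ p ih =>
    rw [chainTerm, ih (i - 1) (by omega) (by omega), multisumTerm_succ hq₀ m p i (by omega)]
    have e2 : Fin.tail s 0 = s 1 := rfl
    rw [e2]
    ring

lemma chainTerm_support (hq₀ : q ≠ 0) (m p i : ℕ) (n : ℤ) (s : Fin (p + 1) → ℤ)
    (h : chainTerm q m p i n s ≠ 0) : s 0 ≤ n ∧ (∀ j : Fin p, s j.succ ≤ s j.castSucc) ∧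
      ∀ j, -((m / 2 : ℕ) : ℤ) ≤ s j := by
  induction p generalizing i n with
  | zero =>
    rw [chainTerm] at h
    refine ⟨?_, fun j => j.elim0, fun j => ?_⟩
    · by_contra h'
      exact left_ne_zero_of_mul h (qFacInv_of_neg (pow_ne_zero 2 hq₀) (by omega))
    · obtain rfl : j = 0 := Fin.ext (by omega)
      by_contra h'
      exact right_ne_zero_of_mul h (chainEnd_eq_zero_of_lt m (by omega))
  | succ p ih =>
    rw [chainTerm] at h
    obtain ⟨h1, h2, h3⟩ := ih _ _ _ (right_ne_zero_of_mul h)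
    refine ⟨?_, fun j => ?_, fun j => ?_⟩
    · by_contra h'
      exact left_ne_zero_of_mul (left_ne_zero_of_mul h) (qFacInv_of_neg hq₀ (by omega))
    · refine Fin.cases ?_ (fun j => ?_) j
      · exact h1
      · exact h2 j
    · refine Fin.cases ?_ (fun j => ?_) j
      · exact (h3 0).trans h1
      · exact h3 j

lemma multisumTerm_support (hq₀ : q ≠ 0) (hq₁ : ‖q‖ < 1) (m p i : ℕ) (hi : i < p + 2)
    (hr : 2 ≤ p + 2) : Function.support (multisumTerm q m (p + 2) i hr) ⊆
      multisumIndex m (p + 2) := by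
  intro s hs
  have h := chainTerm_eq_mul_multisumTerm hq₀ m p i hi hr (s 0) s
  rw [sub_self, qFacInv_zero hq₀ hq₁, one_mul] at h
  obtain ⟨-, h2, h3⟩ := chainTerm_support hq₀ m (p + 1) i (s 0) s (h ▸ hs)
  exact ⟨Fin.antitone_iff_succ_le.2 h2, h3⟩

/-- For k < 0 the reverse triangle inequality gives at least 1/‖q‖ - 1, which exceeds 1 - ‖q‖. The
bound being uniform in k, the denominators do no harm to convergence. -/
lemma norm_one_add_zpow_ge (hq₀ : q ≠ 0) (hq₁ : ‖q‖ < 1) (k : ℤ) : 1 - ‖q‖ ≤ ‖1 + q ^ k‖ := by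
  have h0 : 0 < ‖q‖ := norm_pos_iff.2 hq₀
  rcases lt_trichotomy k 0 with hk | rfl | hk
  · have h1 : 1 ≤ ‖q‖ ^ (k + 1) := one_le_zpow_of_nonpos₀ h0 hq₁.le (by omega)
    have h2 := norm_sub_norm_le (q ^ k) (-1)
    rw [norm_neg, norm_one, norm_zpow, sub_neg_eq_add, add_comm] at h2
    have h3 : ‖q‖ * ‖q‖ ^ k = ‖q‖ ^ (k + 1) := by rw [zpow_add_one₀ h0.ne', mul_comm]
    have h4 : 0 < ‖q‖ ^ k := zpow_pos h0 k
    nlinarith [sq_nonneg (1 - ‖q‖)]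
  · norm_num
    linarith
  · have h1 : ‖q‖ ^ k ≤ ‖q‖ ^ (1 : ℤ) := zpow_le_zpow_right_of_le_one₀ h0 hq₁.le hk
    have h2 := norm_sub_norm_le 1 (-q ^ k)
    rw [norm_neg, norm_one, norm_zpow, sub_neg_eq_add] at h2
    rw [zpow_one] at h1
    linarith

lemma chainKernel_exponent (m p i : ℕ) (j : ℤ) :
    j ^ 2 + ((p - i) * (j ^ 2 + m * j) + i * (j ^ 2 + (m - 1) * j)) =
      (p + 1) * j ^ 2 + (p * m - i) * j := by
  ring

/-- The summand of the bilateral series that the multisum evaluates to. -/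
noncomputable def thetaTerm (q : ℂ) (m p i : ℕ) (j : ℤ) : ℂ :=
  (-1) ^ j * q ^ ((p + 1) * j ^ 2 + (p * m - i) * j) / (1 + q ^ (m + 2 * j)) *
    ∑ k ∈ Finset.range (i + 1), (q ^ (m + 2 * j)) ^ k

lemma chainKernel_eq (hq₀ : q ≠ 0) (m p i : ℕ) (n j : ℤ) :
    chainKernel q m p i n j =
      (-1) ^ j * q ^ ((p + 1) * j ^ 2 + (p * m - i) * j) / (1 + q ^ (m + 2 * j)) *
      baileyKernel q m n j * (∑ k ∈ Finset.range (i + 1), (q ^ (m + 2 * j)) ^ k -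
      q ^ (m + 2 * j) * q ^ (n - j) * ∑ k ∈ Finset.range i, (q ^ (m + 2 * j)) ^ k) := by
  rw [chainKernel, ← chainKernel_exponent, zpow_add₀ hq₀ (j ^ 2)]
  ring

/-- The second sum is superfluous for `thetaTerm`; it serves to dominate the correction term of
`chainKernel` for all n at once. -/
lemma summable_theta_majorant (hq₀ : q ≠ 0) (hq₁ : ‖q‖ < 1) (m p i : ℕ) :
    Summable fun j : ℤ => ‖q‖ ^ ((p + 1) * j ^ 2 + (p * m - i) * j : ℤ) / (1 - ‖q‖) *
      (∑ k ∈ Finset.range (i + 1), (‖q‖ ^ (m + 2 * j)) ^ k +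
      ‖q‖ ^ (m + 2 * j) * ∑ k ∈ Finset.range i, (‖q‖ ^ (m + 2 * j)) ^ k) := by
  have h0 : 0 < ‖q‖ := norm_pos_iff.2 hq₀
  have h : ∀ k : ℕ, Summable fun j : ℤ =>
      ‖q‖ ^ ((p + 1) * j ^ 2 + (p * m - i) * j : ℤ) * (‖q‖ ^ (m + 2 * j)) ^ k := by
    intro k
    refine ((summable_zpow_quadratic h0 hq₁ (show (1 : ℤ) ≤ p + 1 by omega)
      (p * m - i + 2 * k)).mul_left (‖q‖ ^ (m * k : ℤ))).congr fun j => ?_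
    rw [← zpow_natCast, ← zpow_mul, ← zpow_add₀ h0.ne', ← zpow_add₀ h0.ne']
    congr 1
    ring
  have h1 := summable_sum (s := Finset.range (i + 1)) fun k _ => h k
  have h2 := summable_sum (s := Finset.range i) fun k _ => h (k + 1)
  refine ((h1.add h2).mul_left (1 - ‖q‖)⁻¹).congr fun j => ?_
  simp only [pow_succ, ← Finset.mul_sum, ← Finset.sum_mul]
  simp only [mul_assoc]
  ring

lemma norm_thetaTerm_le (hq₀ : q ≠ 0) (hq₁ : ‖q‖ < 1) (m p i : ℕ) (j : ℤ) :
    ‖thetaTerm q m p i j‖ ≤ ‖q‖ ^ ((p + 1) * j ^ 2 + (p * m - i) * j : ℤ) / (1 - ‖q‖) *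
      (∑ k ∈ Finset.range (i + 1), (‖q‖ ^ (m + 2 * j)) ^ k +
      ‖q‖ ^ (m + 2 * j) * ∑ k ∈ Finset.range i, (‖q‖ ^ (m + 2 * j)) ^ k) := by
  have h1 : 0 < 1 - ‖q‖ := by linarith
  rw [thetaTerm, norm_mul, norm_div, norm_mul, norm_zpow, norm_zpow, norm_neg, norm_one,
    one_zpow, one_mul]
  refine mul_le_mul (div_le_div_of_nonneg_left (by positivity) h1
    (norm_one_add_zpow_ge hq₀ hq₁ _)) ?_ (norm_nonneg _) (by positivity)
  refine (norm_sum_le _ _).trans ?_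
  simp only [norm_pow, norm_zpow]
  exact le_add_of_nonneg_right (by positivity)

lemma summable_thetaTerm (hq₀ : q ≠ 0) (hq₁ : ‖q‖ < 1) (m p i : ℕ) :
    Summable (thetaTerm q m p i) :=
  Summable.of_norm_bounded (summable_theta_majorant hq₀ hq₁ m p i)
    (norm_thetaTerm_le hq₀ hq₁ m p i)

lemma tendsto_tsum_chainKernel (hq₀ : q ≠ 0) (hq₁ : ‖q‖ < 1) (m p i : ℕ) :
    Tendsto (fun n : ℕ => ∑' j, chainKernel q m p i n j) atTop
      (𝓝 (∑' j, thetaTerm q m p i j * ((qPochInf q q)⁻¹ * (qPochInf q q)⁻¹))) := by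
  obtain ⟨C, hC0, hC⟩ := exists_norm_qFacInv_le hq₀ hq₁
  have h0 : 0 < ‖q‖ := norm_pos_iff.2 hq₀
  have h1 : 0 < 1 - ‖q‖ := by linarith
  refine tendsto_tsum_of_dominated_convergence
    ((summable_theta_majorant hq₀ hq₁ m p i).mul_left (C * C)) (fun j => ?_)
    (Eventually.of_forall fun n j => ?_)
  · have l1 := (tendsto_qFacInv_of_tendsto hq₀ hq₁ (tendsto_natCast_add_int (-j))).mul
        (tendsto_qFacInv_of_tendsto hq₀ hq₁ (tendsto_natCast_add_int (m + j)))
    have l2 : Tendsto (fun n : ℕ => q ^ ((n : ℤ) - j)) atTop (𝓝 0) := by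
      have := (tendsto_pow_atTop_nhds_zero_of_norm_lt_one hq₁).mul_const (q ^ (-j))
      rw [zero_mul] at this
      refine this.congr fun n => ?_
      rw [← zpow_natCast, ← zpow_add₀ hq₀, sub_eq_add_neg]
    have l3 := ((l1.const_mul ((-1) ^ j * q ^ ((p + 1) * j ^ 2 + (p * m - i) * j) /
      (1 + q ^ (m + 2 * j)))).mul (((l2.const_mul (q ^ (m + 2 * j))).mul_const
        (∑ k ∈ Finset.range i, (q ^ (m + 2 * j)) ^ k)).const_sub
          (∑ k ∈ Finset.range (i + 1), (q ^ (m + 2 * j)) ^ k)))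
    convert! l3 using 2 with n
    · rw [chainKernel_eq hq₀, baileyKernel]
      ring_nf
    · rw [thetaTerm]
      ring
  · rw [chainKernel_eq hq₀]
    -- The factor q^(n-j) is unbounded for j > n, but there the kernel vanishes.
    rcases lt_or_ge (n : ℤ) j with h | h
    · rw [baileyKernel_of_lt hq₀ h, mul_zero, zero_mul, norm_zero]
      positivity
    · have b1 : ‖baileyKernel q m n j‖ ≤ C * C := by
        rw [baileyKernel, norm_mul]
        exact mul_le_mul (hC _) (hC _) (norm_nonneg _) hC0.le
      have b2 : ‖q‖ ^ ((n : ℤ) - j) ≤ 1 := zpow_le_one₀ h0 hq₁.le (by omega)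
      have b3 : ‖∑ k ∈ Finset.range (i + 1), (q ^ (m + 2 * j)) ^ k -
          q ^ (m + 2 * j) * q ^ (n - j) * ∑ k ∈ Finset.range i, (q ^ (m + 2 * j)) ^ k‖ ≤
          ∑ k ∈ Finset.range (i + 1), (‖q‖ ^ (m + 2 * j)) ^ k +
            ‖q‖ ^ (m + 2 * j) * ∑ k ∈ Finset.range i, (‖q‖ ^ (m + 2 * j)) ^ k := by
        refine (norm_sub_le _ _).trans (add_le_add ?_ ?_)
        · refine (norm_sum_le _ _).trans_eq ?_
          simp only [norm_pow, norm_zpow]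
        · rw [norm_mul, norm_mul, norm_zpow, norm_zpow]
          refine mul_le_mul (mul_le_of_le_one_right (by positivity) b2) ?_ (norm_nonneg _)
            (by positivity)
          refine (norm_sum_le _ _).trans_eq ?_
          simp only [norm_pow, norm_zpow]
      have b4 : ‖(-1) ^ j * q ^ ((p + 1) * j ^ 2 + (p * m - i) * j) / (1 + q ^ (m + 2 * j))‖ ≤
          ‖q‖ ^ ((p + 1) * j ^ 2 + (p * m - i) * j : ℤ) / (1 - ‖q‖) := by
        rw [norm_div, norm_mul, norm_zpow, norm_zpow, norm_neg, norm_one, one_zpow, one_mul]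
        exact div_le_div_of_nonneg_left (by positivity) h1 (norm_one_add_zpow_ge hq₀ hq₁ _)
      rw [norm_mul, norm_mul, mul_comm ‖_ / _‖, mul_assoc]
      exact mul_le_mul b1 (mul_le_mul b4 b3 (norm_nonneg _) (by positivity)) (by positivity)
        (by positivity)

lemma hasSum_multisumTerm (hq₀ : q ≠ 0) (hq₁ : ‖q‖ < 1) (m p i : ℕ) (hi : i < p + 2)
    (hr : 2 ≤ p + 2) :
    HasSum (multisumTerm q m (p + 2) i hr)
      ((∑' j, thetaTerm q m (p + 1) i j) / qPochInf q q) := by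
  have hP := qPochInf_self_ne_zero hq₀ hq₁
  obtain ⟨C, hC0, hC⟩ := exists_norm_qFacInv_le hq₀ hq₁
  obtain ⟨B, hB, hB'⟩ := exists_chainTerm_bound hq₀ hq₁ m (p + 1) i
  have hbound : ∀ s, ‖multisumTerm q m (p + 2) i hr s‖ ≤ B s := fun s => by
    have h := chainTerm_eq_mul_multisumTerm hq₀ m p i hi hr (s 0) s
    rw [sub_self, qFacInv_zero hq₀ hq₁, one_mul] at h
    exact h ▸ hB' _ _
  have hs : Summable (multisumTerm q m (p + 2) i hr) := Summable.of_norm_bounded hB hbound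
  have lim1 : Tendsto (fun n : ℕ => ∑' s, chainTerm q m (p + 1) i n s) atTop
      (𝓝 (∑' s, (qPochInf q q)⁻¹ * multisumTerm q m (p + 2) i hr s)) := by
    refine tendsto_tsum_of_dominated_convergence hB (fun s => ?_)
      (Eventually.of_forall fun n s => hB' _ _)
    simp only [chainTerm_eq_mul_multisumTerm hq₀ m p i hi hr]
    exact (tendsto_qFacInv_of_tendsto hq₀ hq₁ (tendsto_natCast_add_int (-s 0))).mul_const _
  have lim2 : Tendsto (fun n : ℕ => ∑' s, chainTerm q m (p + 1) i n s) atTop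
      (𝓝 (∑' j, thetaTerm q m (p + 1) i j * ((qPochInf q q)⁻¹ * (qPochInf q q)⁻¹))) := by
    refine (tendsto_tsum_chainKernel hq₀ hq₁ m (p + 1) i).congr fun n => ?_
    rw [(hasSum_chainTerm hq₀ hq₁ m (p + 1) i (by omega) n).tsum_eq]
    exact tsum_eq_sum fun j hj => chainKernel_of_notMem hq₀ m (p + 1) i hj
  -- One limit carries a single factor 1/(q)_∞, the other two; cancelling leaves one.
  have heq := tendsto_nhds_unique lim1 lim2
  rw [tsum_mul_left, tsum_mul_right] at heq
  convert! hs.hasSum using 1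
  field_simp at heq ⊢
  rw [heq]

end Multisum

/-! ### Symmetrization and evaluation by theta products -/

section Evaluation

variable {q : ℂ}

lemma sum_range_inv_pow {x : ℂ} (hx : x ≠ 0) (n : ℕ) :
    ∑ k ∈ Finset.range (n + 1), x⁻¹ ^ k = (x ^ n)⁻¹ * ∑ k ∈ Finset.range (n + 1), x ^ k := by
  rw [← Finset.sum_range_reflect, Finset.mul_sum]
  refine Finset.sum_congr rfl fun k hk => ?_
  have hk' : k ≤ n := Nat.lt_succ_iff.1 (Finset.mem_range.1 hk)
  rw [show n + 1 - 1 - k = n - k by omega, inv_pow, ← Nat.sub_add_cancel hk', pow_add,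
    Nat.add_sub_cancel]
  field_simp

lemma zpow_theta_reflect (hq₀ : q ≠ 0) (m p i : ℕ) (j : ℤ) :
    (-1 : ℂ) ^ (-m - j) * q ^ ((p + 1) * (-m - j) ^ 2 + (p * m - i) * (-m - j)) =
      (-1) ^ m * ((-1) ^ j * q ^ ((p + 1) * j ^ 2 + (p * m - i) * j)) *
        (q ^ (m + 2 * j)) ^ (m + i) := by
  have e : (-1 : ℂ) ^ (-m - j) = (-1) ^ m * (-1) ^ j := by
    rw [show -m - j = -(m + j) by ring, zpow_neg, ← inv_zpow, zpow_add₀ (by norm_num),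
      zpow_natCast]
    norm_num
  rw [e, ← zpow_natCast (q ^ (m + 2 * j)), ← zpow_mul,
    zpow_of_eq_add hq₀ (show (p + 1) * (-m - j) ^ 2 + (p * m - i) * (-m - j) =
      ((p + 1) * j ^ 2 + (p * m - i) * j) + (m + 2 * j) * (m + i : ℕ) by push_cast; ring)]
  ring

lemma zpow_reflect (m : ℕ) (j : ℤ) : q ^ (m + 2 * (-m - j)) = (q ^ (m + 2 * j))⁻¹ := by
  rw [← zpow_neg]
  congr 1
  ring

/-- The quadratic exponent contributes x^(m+i), the denominator x, and the reversed geometric sum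
x^(-i), where x = q^(m+2j). -/
lemma thetaTerm_reflect (hq₀ : q ≠ 0) (hq₁ : ‖q‖ < 1) (m p i : ℕ) (j : ℤ) :
    thetaTerm q m p i (-m - j) = (-1) ^ m * (q ^ (m + 2 * j)) ^ (m + 1) * thetaTerm q m p i j := by
  rw [thetaTerm, thetaTerm, zpow_theta_reflect hq₀, zpow_reflect]
  have hx₀ : q ^ (m + 2 * j) ≠ 0 := zpow_ne_zero _ hq₀
  have hx : 1 + q ^ (m + 2 * j) ≠ 0 := one_add_zpow_ne_zero hq₀ hq₁ _
  rw [sum_range_inv_pow hx₀]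
  generalize q ^ (m + 2 * j) = x at *
  rw [pow_add x m i, show 1 + x⁻¹ = (1 + x) * x⁻¹ by field_simp; ring]
  field_simp
  ring

lemma hasSum_reflect {f : ℤ → ℂ} {a : ℂ} (m : ℤ) (h : HasSum f a) :
    HasSum (fun j => f (m - j)) a :=
  (Equiv.subLeft m).hasSum_iff.2 h

lemma hasSum_thetaTerm_even (hq₀ : q ≠ 0) (hq₁ : ‖q‖ < 1) (m p i : ℕ) :
    HasSum (thetaTerm q (2 * m) p i)
      (∑ k ∈ Finset.range (i + 1), ∑ l ∈ Finset.range (2 * m + 1),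
        (-1) ^ l * q ^ (2 * m * k + 2 * m * l) * (qPochInf₃ (q ^ (2 * (p + 1)))
          (q ^ (2 * m * p + (p + 1) - i + 2 * k + 2 * l : ℤ))
          (q ^ ((p + 1) + i - 2 * m * p - 2 * k - 2 * l : ℤ)) (q ^ (2 * (p + 1))) / 2)) := by
  have hs := (summable_thetaTerm hq₀ hq₁ (2 * m) p i).hasSum
  have h2 := hs.add (hasSum_reflect (-(2 * m : ℕ)) hs)
  have h3 := hasSum_sum (s := Finset.range (i + 1)) fun k _ =>
    hasSum_sum (s := Finset.range (2 * m + 1)) fun l _ =>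
      (hasSum_tripleProduct hq₀ hq₁ (Nat.succ_ne_zero p)
        (p * (2 * m : ℕ) - i + 2 * k + 2 * l)).mul_left ((-1) ^ l * q ^ (2 * m * k + 2 * m * l))
  have h4 : (fun j => thetaTerm q (2 * m) p i j + thetaTerm q (2 * m) p i (-(2 * m : ℕ) - j)) =
      fun j : ℤ => ∑ k ∈ Finset.range (i + 1), ∑ l ∈ Finset.range (2 * m + 1),
        (-1) ^ l * q ^ (2 * m * k + 2 * m * l) * ((-1) ^ j *
          q ^ ((p + 1 : ℕ) * j ^ 2 + (p * (2 * m : ℕ) - i + 2 * k + 2 * l) * j)) := by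
    funext j
    rw [thetaTerm_reflect hq₀ hq₁, thetaTerm]
    have hx : 1 + q ^ ((2 * m : ℕ) + 2 * j) ≠ 0 := one_add_zpow_ne_zero hq₀ hq₁ _
    have hterm : ∀ k l : ℕ, (-1 : ℂ) ^ l * q ^ (2 * m * k + 2 * m * l) * ((-1) ^ j *
        q ^ ((p + 1 : ℕ) * j ^ 2 + (p * (2 * m : ℕ) - i + 2 * k + 2 * l) * j)) =
        (-1) ^ j * q ^ ((p + 1) * j ^ 2 + (p * (2 * m : ℕ) - i) * j) *
          ((q ^ ((2 * m : ℕ) + 2 * j)) ^ k * (-q ^ ((2 * m : ℕ) + 2 * j)) ^ l) := by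
      intro k l
      have e : q ^ (2 * m * k + 2 * m * l) *
          q ^ ((p + 1 : ℕ) * j ^ 2 + (p * (2 * m : ℕ) - i + 2 * k + 2 * l) * j) =
          q ^ ((p + 1) * j ^ 2 + (p * (2 * m : ℕ) - i) * j) *
          ((q ^ ((2 * m : ℕ) + 2 * j)) ^ k * (q ^ ((2 * m : ℕ) + 2 * j)) ^ l) := by
        rw [← zpow_natCast q (2 * m * k + 2 * m * l), ← zpow_natCast _ k, ← zpow_natCast _ l,
          ← zpow_mul, ← zpow_mul, ← zpow_add₀ hq₀, ← zpow_add₀ hq₀, ← zpow_add₀ hq₀]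
        congr 1
        push_cast
        ring
      rw [neg_pow (q ^ ((2 * m : ℕ) + 2 * j)) l]
      linear_combination ((-1) ^ l * (-1) ^ j) * e
    simp only [hterm]
    simp only [← Finset.mul_sum, ← Finset.sum_mul]
    generalize q ^ ((2 * m : ℕ) + 2 * j) = x at *
    -- The odd exponent gives 1 + x^(2m+1) = (1 + x) Σ (-x)^l, which cancels the denominator.
    have hg := mul_neg_geom_sum (-x) (2 * m + 1)
    rw [sub_neg_eq_add, Odd.neg_pow ⟨m, rfl⟩, sub_neg_eq_add] at hg
    rw [(even_two_mul m).neg_one_pow, one_mul, div_mul_eq_mul_div]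
    field_simp
    linear_combination (-(∑ k ∈ Finset.range (i + 1), x ^ k)) * hg
  rw [h4] at h2
  have h5 := h2.unique h3
  convert! hs using 1
  have h6 : (∑' j, thetaTerm q (2 * m) p i j) =
      (∑' j, thetaTerm q (2 * m) p i j + ∑' j, thetaTerm q (2 * m) p i j) / 2 := by ring
  rw [h6, h5, Finset.sum_div]
  refine Finset.sum_congr rfl fun k _ => ?_
  rw [Finset.sum_div]
  refine Finset.sum_congr rfl fun l _ => ?_
  rw [mul_div_assoc]
  congr 4 <;> push_cast <;> ring

lemma hasSum_thetaTerm_odd (hq₀ : q ≠ 0) (hq₁ : ‖q‖ < 1) (m p i : ℕ) :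
    HasSum (thetaTerm q (2 * m + 1) p i)
      ((-1) ^ m * q ^ ((1 - p) * m ^ 2 + (i - p) * m : ℤ) *
        ∑ l ∈ Finset.range (m + 1), q ^ (2 * l) * qPochInf₃ (q ^ (2 * (p + 1)))
          (q ^ (2 * (p + 1) - 2 * m - 1 - i + 4 * l : ℤ))
          (q ^ (i + 2 * m + 1 - 4 * l : ℤ)) (q ^ (2 * (p + 1)))) := by
  have hs := (summable_thetaTerm hq₀ hq₁ (2 * m + 1) p i).hasSum
  have h2 := hs.add (hasSum_reflect (-(2 * m + 1 : ℕ)) hs)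
  -- f has neither denominator nor inner geometric sum, yet its symmetrization is that of
  -- `thetaTerm`; hence both have the same total. The shift of j by m in `h3` accounts for the
  -- prefactor of the odd value.
  set f : ℤ → ℂ := fun j => (-1) ^ j *
    q ^ ((p + 1) * j ^ 2 + (p * (2 * m + 1 : ℕ) - i) * j) *
      ∑ l ∈ Finset.range (m + 1), ((q ^ ((2 * m + 1 : ℕ) + 2 * j)) ^ 2) ^ l with hf
  have h3 := (hasSum_sum (s := Finset.range (m + 1)) fun l _ =>
    ((hasSum_sub_iff (-m)).2 (hasSum_tripleProduct hq₀ hq₁ (Nat.succ_ne_zero p)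
      (p - 2 * m - i + 4 * l))).mul_left (q ^ (2 * l))).mul_left
        ((-1) ^ m * q ^ ((1 - p) * m ^ 2 + (i - p) * m : ℤ))
  have h4 : f = fun j : ℤ => (-1) ^ m * q ^ ((1 - p) * m ^ 2 + (i - p) * m : ℤ) *
      ∑ l ∈ Finset.range (m + 1), q ^ (2 * l) * ((-1) ^ (j - -m) *
        q ^ ((p + 1 : ℕ) * (j - -m) ^ 2 + (p - 2 * m - i + 4 * l) * (j - -m))) := by
    funext j
    simp only [hf]
    rw [Finset.mul_sum, Finset.mul_sum]
    refine Finset.sum_congr rfl fun l _ => ?_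
    have e1 : q ^ ((p + 1) * j ^ 2 + (p * (2 * m + 1 : ℕ) - i) * j) *
        ((q ^ ((2 * m + 1 : ℕ) + 2 * j)) ^ 2) ^ l =
        q ^ ((1 - p) * m ^ 2 + (i - p) * m : ℤ) * (q ^ (2 * l) *
        q ^ ((p + 1 : ℕ) * (j - -m) ^ 2 + (p - 2 * m - i + 4 * l) * (j - -m))) := by
      rw [← pow_mul, ← zpow_natCast _ (2 * l), ← zpow_natCast _ (2 * l), ← zpow_mul,
        ← zpow_add₀ hq₀, ← zpow_add₀ hq₀, ← zpow_add₀ hq₀]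
      congr 1
      push_cast
      ring
    have e2 : (-1 : ℂ) ^ (j - -m) = (-1) ^ m * (-1) ^ j := by
      rw [sub_neg_eq_add, zpow_add₀ (by norm_num), zpow_natCast, mul_comm]
    have e3 : (-1 : ℂ) ^ m * (-1) ^ m = 1 := by rw [← mul_pow]; simp
    rw [mul_assoc, e1, e2]
    linear_combination (-((-1) ^ j * (q ^ ((1 - p) * m ^ 2 + (i - p) * m : ℤ) * (q ^ (2 * l) *
        q ^ ((p + 1 : ℕ) * (j - -m) ^ 2 + (p - 2 * m - i + 4 * l) * (j - -m)))))) * e3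
  rw [← h4] at h3
  have h5 : (fun j => thetaTerm q (2 * m + 1) p i j +
      thetaTerm q (2 * m + 1) p i (-(2 * m + 1 : ℕ) - j)) =
      fun j => f j + f (-(2 * m + 1 : ℕ) - j) := by
    funext j
    rw [thetaTerm_reflect hq₀ hq₁, thetaTerm]
    simp only [hf]
    rw [zpow_theta_reflect hq₀, zpow_reflect]
    have hx : 1 + q ^ ((2 * m + 1 : ℕ) + 2 * j) ≠ 0 := one_add_zpow_ne_zero hq₀ hq₁ _
    have hx₀ : q ^ ((2 * m + 1 : ℕ) + 2 * j) ≠ 0 := zpow_ne_zero _ hq₀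
    generalize q ^ ((2 * m + 1 : ℕ) + 2 * j) = x at *
    rw [inv_pow x 2, sum_range_inv_pow (pow_ne_zero 2 hx₀)]
    have hg := mul_neg_geom_sum (x ^ 2) (m + 1)
    have hg' := mul_neg_geom_sum x (i + 1)
    rw [Odd.neg_one_pow ⟨m, rfl⟩]
    have e1 : x ^ (2 * m + 1 + i) * ((x ^ 2) ^ m)⁻¹ = x ^ (i + 1) := by
      rw [← pow_mul, show 2 * m + 1 + i = i + 1 + 2 * m by ring, pow_add x (i + 1)]
      field_simp
    have e2 : x ^ (2 * m + 1 + 1) = (x ^ 2) ^ (m + 1) := by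
      rw [← pow_mul]
      ring
    rw [e2]
    generalize (∑ k ∈ Finset.range (m + 1), (x ^ 2) ^ k) = S at *
    generalize (∑ k ∈ Finset.range (i + 1), x ^ k) = G at *
    generalize (-1 : ℂ) ^ j * q ^ ((p + 1) * j ^ 2 + (p * (2 * m + 1 : ℕ) - i) * j) = W
    -- The mirror image of f is -x^(i+1) times f, so the two add up to W S (1 - x^(i+1)).
    have e3 : W * S + -1 * W * x ^ (2 * m + 1 + i) * (((x ^ 2) ^ m)⁻¹ * S) =
        W * S * ((1 - x) * G) := by
      rw [hg', ← e1]
      ring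
    rw [e3, show (x ^ 2) ^ (m + 1) = 1 - (1 - x ^ 2) * S by rw [hg]; ring]
    field_simp
    ring
  rw [h5] at h2
  have h6 := h2.unique (h3.add (hasSum_reflect (-(2 * m + 1 : ℕ)) h3))
  have h7 : ∀ a b : ℂ, a + a = b + b → b = a := fun a b h => by linear_combination (-1 / 2) * h
  convert! hs using 1
  rw [← h7 _ _ h6]
  congr 1
  refine Finset.sum_congr rfl fun l _ => ?_
  congr 3 <;> push_cast <;> ring

lemma tsum_thetaTerm_div (hq₀ : q ≠ 0) (hq₁ : ‖q‖ < 1) (m p i : ℕ) :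
    (∑' j, thetaTerm q m p i j) / qPochInf q q = bressoudA q m (p + 1) i := by
  rw [bressoudA]
  split_ifs with h
  · obtain ⟨m, rfl⟩ := even_iff_exists_two_mul.1 h
    rw [(hasSum_thetaTerm_even hq₀ hq₁ m p i).tsum_eq, Nat.mul_div_cancel_left m two_pos,
      bressoudEven, Finset.sum_div]
    refine Finset.sum_congr rfl fun k _ => ?_
    rw [Finset.sum_div]
    refine Finset.sum_congr rfl fun l _ => ?_
    rw [mul_div_assoc, div_div]
    congr 5 <;> push_cast <;> ring
  · obtain ⟨m, rfl⟩ := Nat.not_even_iff_odd.1 h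
    rw [(hasSum_thetaTerm_odd hq₀ hq₁ m p i).tsum_eq, show (2 * m + 1) / 2 = m by omega,
      bressoudOdd, mul_div_assoc, Finset.sum_div]
    congr 1
    · congr 2
      push_cast
      ring
    · refine Finset.sum_congr rfl fun l _ => ?_
      rw [mul_div_assoc]
      congr 4

end Evaluation

theorem theorem2p5 (q : ℂ) (hq₀ : q ≠ 0) (hq₁ : ‖q‖ < 1) (m r i : ℕ) (hr : 2 ≤ r) (hi : i < r) :
    HasSum (fun s : multisumIndex m r => multisumTerm q m r i hr s) (bressoudA q m r i) := by
  obtain ⟨p, rfl⟩ : ∃ p, r = p + 2 := ⟨r - 2, by omega⟩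
  rw [← tsum_thetaTerm_div hq₀ hq₁ m (p + 1) i]
  -- Terms outside the index set vanish, so the sum over all of ℤ^r is the required one.
  exact (hasSum_subtype_iff_of_support_subset (multisumTerm_support hq₀ hq₁ m p i hi hr)).2
    (hasSum_multisumTerm hq₀ hq₁ m p i hi hr)
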